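/- Let $M$ be an $n$-dimensional $C^\infty$ manifold, $g$ a semi-Riemannian metric on $M$ of signature $(r,s)$ (a $C^\infty$ symmetric nondegenerate $(0,2)$-tensor field of that signature), $\nabla$ its Levi-Civita connection, with components $\Gamma^i_{jk}$ in a chart $(x^i)$, let $X$ be a $C^\infty$ vector field on $M$, and let $f=\tfrac12 g(X,X):M\to\mathbb R$. Consider the second-order system $$\frac{\nabla}{dt}\frac{dx}{dt}=\operatorname{grad} f .\tag{3'}$$ On the tangent bundle $TM$, with the coordinates $(x^i,y^i)$ induced by a chart $(x^i)$ of $M$, put $\delta y^j=dy^j+\Gamma^j_{hk}\,y^k\,dx^h$, and $$\Omega_1=g_{ij}\,dx^i\wedge\delta y^j,\qquad \eta_1=g_{ij}\,y^i\,dx^j,\qquad H(x,y)=\tfrac12 g_x(y,y)-f(x).$$ **Theorem.** 1. $\Omega_1$ and $\eta_1$ do not depend on the chart and are smooth differential forms on $TM$; $\Omega_1=-d\eta_1$, and $\Omega_1$ is a symplectic form (closed and nondegenerate). 2. The function $H$ is $C^\infty$, and there is exactly one vector field $X_H$ on $TM$ with $\Omega_1(X_H,v)=dH(v)$ for all tangent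 vectors $v$ of $TM$; it is $C^\infty$. 3. The system (3') lifts to $TM$ as the Hamilton system of $H$ with respect to $\Omega_1$: for every open set $J\subseteq\mathbb R$, a curve $\gamma:J\to TM$ is a solution of the Hamilton equations $\dot\gamma=X_H(\gamma)$ if and only if its projection $x$ to $M$ is a $C^2$ solution of (3') on $J$ and $\gamma(t)=\left(x(t),\tfrac{dx}{dt}(t)\right)$ for all $t\in J$. -/

import Mathlib

open Set
open scoped Manifold ContDiff Topology

noncomputable section

namespace GeomDyn

/-! ### Differential forms on a manifold -/

section Forms

variable {E : Type*} [NormedAddCommGroup E] [NormedSpace ℝ E]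
  {H : Type*} [TopologicalSpace H] (I : ModelWithCorners ℝ E H)
  {N : Type*} [TopologicalSpace N] [ChartedSpace H N]

/-- The coordinate representation, in the preferred chart around `p`, of a differential `k`-form:
its pullback by the inverse of the chart. -/
def formInChart {k : ℕ} (α : ∀ q : N, TangentSpace I q [⋀^Fin k]→L[ℝ] ℝ) (p : N) :
    E → E [⋀^Fin k]→L[ℝ] ℝ := fun z =>
  (α ((extChartAt I p).symm z)).compContinuousLinearMap
    (mfderivWithin 𝓘(ℝ, E) I (extChartAt I p).symm (range I) z)

/-- A differential form is smooth if all its coordinate representations are. -/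
def IsSmoothForm {k : ℕ} (α : ∀ q : N, TangentSpace I q [⋀^Fin k]→L[ℝ] ℝ) : Prop :=
  ∀ p : N, ContDiffOn ℝ ∞ (formInChart I α p) (extChartAt I p).target

/-- The exterior derivative `dα` of a differential form on a manifold: at `p`, pull `α` back to the
model space by the inverse of the chart around `p`, take the exterior derivative there, and pull
the result back by the chart. -/
def extDer {k : ℕ} (α : ∀ q : N, TangentSpace I q [⋀^Fin k]→L[ℝ] ℝ) (p : N) :
    TangentSpace I p [⋀^Fin (k + 1)]→L[ℝ] ℝ :=
  (extDerivWithin (formInChart I α p) (range I) (extChartAt I p p)).compContinuousLinearMap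
    (mfderiv I 𝓘(ℝ, E) (extChartAt I p) p)

/-- A symplectic form: a smooth, closed and nondegenerate 2-form. -/
structure IsSymplectic (α : ∀ q : N, TangentSpace I q [⋀^Fin 2]→L[ℝ] ℝ) : Prop where
  smooth : IsSmoothForm I α
  closed : ∀ p : N, extDer I α p = 0
  nondegenerate : ∀ (p : N) (u : TangentSpace I p),
    (∀ v : TangentSpace I p, α p ![u, v] = 0) → u = 0

/-- `Z` is a Hamilton gradient of the function `h`, with respect to the 2-form `α`:
`α_p (Z(p), v) = dh(p)(v)` for all tangent vectors `v` at `p`. -/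
def IsHamiltonGradient (α : ∀ q : N, TangentSpace I q [⋀^Fin 2]→L[ℝ] ℝ) (h : N → ℝ)
    (Z : ∀ q : N, TangentSpace I q) : Prop :=
  ∀ (p : N) (v : TangentSpace I p), α p ![Z p, v] = mfderiv I 𝓘(ℝ, ℝ) h p v

end Forms

/-- The wedge product of two covectors. -/
def wedge {V : Type*} [AddCommGroup V] [Module ℝ V] [TopologicalSpace V]
    (α β : V →L[ℝ] ℝ) : V [⋀^Fin 2]→L[ℝ] ℝ :=
  ((ContinuousMultilinearMap.mkPiAlgebra ℝ (Fin 2) ℝ).compContinuousLinearMap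
    ![α, β]).alternatization

/-- The normalization of the wedge product. -/
theorem wedge_apply {V : Type*} [AddCommGroup V] [Module ℝ V] [TopologicalSpace V]
    (α β : V →L[ℝ] ℝ) (u v : V) : wedge α β ![u, v] = α u * β v - α v * β u := by
  have hu : (Finset.univ : Finset (Equiv.Perm (Fin 2))) = {1, Equiv.swap 0 1} := by decide
  have hn : (1 : Equiv.Perm (Fin 2)) ≠ Equiv.swap 0 1 := by decide
  simp only [wedge, ContinuousMultilinearMap.alternatization_apply_apply]
  rw [hu, Finset.sum_pair hn]
  simp [Fin.prod_univ_two]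
  ring

/-! ### Semi-Riemannian metrics -/

/-- A semi-Riemannian metric of signature `(r, s)` on an `n`-dimensional smooth manifold: a smooth
symmetric tensor field of type `(0, 2)`, nondegenerate with `r` positive and `s` negative squares
on every tangent space. -/
structure SemiRiemannianMetric (n r s : ℕ) (M : Type*) [TopologicalSpace M]
    [ChartedSpace (EuclideanSpace ℝ (Fin n)) M] [IsManifold (𝓡 n) ∞ M] where
  /-- The bilinear form on each tangent space. -/
  val (x : M) : TangentSpace (𝓡 n) x →L[ℝ] TangentSpace (𝓡 n) x →L[ℝ] ℝ
  symm (x : M) (v w : TangentSpace (𝓡 n) x) : val x v w = val x w v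
  nondegenerate (x : M) (v : TangentSpace (𝓡 n) x) : (∀ w, val x v w = 0) → v = 0
  signature (x : M) : ∃ b : Module.Basis (Fin r ⊕ Fin s) ℝ (TangentSpace (𝓡 n) x),
    ∀ i j, val x (b i) (b j) = if i = j then Sum.elim (fun _ => 1) (fun _ => -1) i else 0
  contMDiff : ContMDiff (𝓡 n)
    ((𝓡 n).prod 𝓘(ℝ, EuclideanSpace ℝ (Fin n) →L[ℝ] EuclideanSpace ℝ (Fin n) →L[ℝ] ℝ)) ∞
    (fun x => Bundle.TotalSpace.mk'
      (EuclideanSpace ℝ (Fin n) →L[ℝ] EuclideanSpace ℝ (Fin n) →L[ℝ] ℝ)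
      (E := fun x : M => TangentSpace (𝓡 n) x →L[ℝ] TangentSpace (𝓡 n) x →L[ℝ] ℝ) x (val x))

section Metric

variable {n r s : ℕ} {M : Type*} [TopologicalSpace M]
  [ChartedSpace (EuclideanSpace ℝ (Fin n)) M] [IsManifold (𝓡 n) ∞ M]
  (g : SemiRiemannianMetric n r s M)

/-- The component `g_{ij}` of the metric in the chart `e`, as a function on the model space:
`g_{ij} = g(∂_i, ∂_j)` where `∂_i` is the coordinate vector field. -/
def metricComp (e : OpenPartialHomeomorph M (EuclideanSpace ℝ (Fin n))) (i j : Fin n)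
    (z : EuclideanSpace ℝ (Fin n)) : ℝ :=
  g.val (e.symm z)
    (mfderiv (𝓡 n) (𝓡 n) e.symm z (EuclideanSpace.single i (1 : ℝ)))
    (mfderiv (𝓡 n) (𝓡 n) e.symm z (EuclideanSpace.single j (1 : ℝ)))

/-- The partial derivative `∂φ/∂x^i` of a function on the model space. -/
def partialDeriv (i : Fin n) (φ : EuclideanSpace ℝ (Fin n) → ℝ)
    (z : EuclideanSpace ℝ (Fin n)) : ℝ :=
  fderiv ℝ φ z (EuclideanSpace.single i (1 : ℝ))

/-- The component `Γ^k_{ij}` of the Levi-Civita connection of `g` in the chart `e`: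
`Γ^k_{ij} = (1/2) g^{kl} (∂_i g_{jl} + ∂_j g_{il} - ∂_l g_{ij})`. -/
def christoffel (e : OpenPartialHomeomorph M (EuclideanSpace ℝ (Fin n))) (k i j : Fin n)
    (z : EuclideanSpace ℝ (Fin n)) : ℝ :=
  (1 / 2) * ∑ l, (Matrix.of fun a b => metricComp g e a b z)⁻¹ k l *
    (partialDeriv i (metricComp g e j l) z + partialDeriv j (metricComp g e i l) z
      - partialDeriv l (metricComp g e i j) z)

/-- The gradient `grad φ` of a function: the vector field that the metric, as a map from tangent
vectors to covectors, sends to `dφ`. -/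
def grad (φ : M → ℝ) (x : M) : TangentSpace (𝓡 n) x :=
  (g.val x).inverse (mfderiv (𝓡 n) 𝓘(ℝ, ℝ) φ x)

/-- The velocity `dx/dt` of a curve in `M`. -/
def velocity (x : ℝ → M) (t : ℝ) : TangentSpace (𝓡 n) (x t) :=
  mfderiv 𝓘(ℝ, ℝ) (𝓡 n) x t (1 : ℝ)

/-- The covariant derivative `∇V/dt` of a vector field `V` along the curve `x`, for the Levi-Civita
connection: its components are `dV^k/dt + Γ^k_{ij} (dx^i/dt) V^j` (computed in the preferred chart
around `x t`). -/
def covDerivAlong (x : ℝ → M) (V : ∀ t, TangentSpace (𝓡 n) (x t)) (t : ℝ) :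
    TangentSpace (𝓡 n) (x t) :=
  let e := chartAt (EuclideanSpace ℝ (Fin n)) (x t)
  let W : ℝ → EuclideanSpace ℝ (Fin n) := fun τ =>
    NormedSpace.fromTangentSpace (𝕜 := ℝ) (e (x τ)) (mfderiv (𝓡 n) (𝓡 n) e (x τ) (V τ))
  (mfderiv (𝓡 n) (𝓡 n) e (x t)).inverse
    (WithLp.toLp 2 fun k => deriv (fun τ => W τ k) t +
      ∑ i, ∑ j, christoffel g e k i j (e (x t)) * deriv (fun τ => e (x τ) i) t * W t j)

/-- `x` is, on the set `J` of times, a trajectory of the potential dynamical system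
`(∇/dt)(dx/dt) = grad f`. -/
def IsTrajectoryOn (f : M → ℝ) (x : ℝ → M) (J : Set ℝ) : Prop :=
  ContMDiffOn 𝓘(ℝ, ℝ) (𝓡 n) 2 x J ∧
    ∀ t ∈ J, covDerivAlong g x (velocity x) t = grad g f (x t)

/-- The energy `f = (1/2) g(X, X)` of a vector field. -/
def energy (X : ∀ x : M, TangentSpace (𝓡 n) x) (x : M) : ℝ :=
  (1 / 2) * g.val x (X x) (X x)

/-- The Hamiltonian `H(x, y) = (1/2) g(y, y) - f(x)` on the tangent bundle. -/
def hamiltonian (f : M → ℝ) (p : TangentBundle (𝓡 n) M) : ℝ :=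
  (1 / 2) * g.val p.proj p.snd p.snd - f p.proj

/-- The lift `t ↦ (x(t), dx/dt)` of a curve in `M` to the tangent bundle. -/
def lift (x : ℝ → M) (t : ℝ) : TangentBundle (𝓡 n) M := ⟨x t, velocity x t⟩

/-! ### Forms on the tangent bundle

A chart `e = (x^i)` of `M` induces the coordinates `(x^i, y^i)` on `TM`. -/

/-- The function `x^i` on `TM`. -/
def coordX (e : OpenPartialHomeomorph M (EuclideanSpace ℝ (Fin n))) (i : Fin n)
    (p : TangentBundle (𝓡 n) M) : ℝ :=
  e p.proj i

/-- The function `y^i` on `TM`: the `i`-th component of the tangent vector in the chart `e`. -/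
def coordY (e : OpenPartialHomeomorph M (EuclideanSpace ℝ (Fin n))) (i : Fin n)
    (p : TangentBundle (𝓡 n) M) : ℝ :=
  NormedSpace.fromTangentSpace (𝕜 := ℝ) (e p.proj) (mfderiv (𝓡 n) (𝓡 n) e p.proj p.snd) i

/-- The covector `dx^i` at `p`. -/
def dX (e : OpenPartialHomeomorph M (EuclideanSpace ℝ (Fin n))) (i : Fin n)
    (p : TangentBundle (𝓡 n) M) : TangentSpace (𝓡 n).tangent p →L[ℝ] ℝ :=
  mfderiv (𝓡 n).tangent 𝓘(ℝ, ℝ) (coordX e i) p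

/-- The covector `dy^i` at `p`. -/
def dY (e : OpenPartialHomeomorph M (EuclideanSpace ℝ (Fin n))) (i : Fin n)
    (p : TangentBundle (𝓡 n) M) : TangentSpace (𝓡 n).tangent p →L[ℝ] ℝ :=
  mfderiv (𝓡 n).tangent 𝓘(ℝ, ℝ) (coordY e i) p

/-- The covector `δy^j = dy^j + Γ^j_{hk} y^k dx^h` at `p`. -/
def deltaY (e : OpenPartialHomeomorph M (EuclideanSpace ℝ (Fin n))) (j : Fin n)
    (p : TangentBundle (𝓡 n) M) : TangentSpace (𝓡 n).tangent p →L[ℝ] ℝ :=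
  dY e j p + ∑ h, ∑ k, (christoffel g e j h k (e p.proj) * coordY e k p) • dX e h p

/-- The 2-form `g_{ij} dx^i ∧ δy^j` of the chart `e`. -/
def Omega1In (e : OpenPartialHomeomorph M (EuclideanSpace ℝ (Fin n)))
    (p : TangentBundle (𝓡 n) M) : TangentSpace (𝓡 n).tangent p [⋀^Fin 2]→L[ℝ] ℝ :=
  ∑ i, ∑ j, metricComp g e i j (e p.proj) • wedge (dX e i p) (deltaY g e j p)

/-- The 1-form `g_{ij} y^i dx^j` of the chart `e`. -/
def eta1In (e : OpenPartialHomeomorph M (EuclideanSpace ℝ (Fin n)))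
    (p : TangentBundle (𝓡 n) M) : TangentSpace (𝓡 n).tangent p [⋀^Fin 1]→L[ℝ] ℝ :=
  ContinuousAlternatingMap.ofSubsingleton ℝ (TangentSpace (𝓡 n).tangent p) ℝ (0 : Fin 1)
    (∑ i, ∑ j, (metricComp g e i j (e p.proj) * coordY e i p) • dX e j p)

/-- The 2-form `Ω₁ = g_{ij} dx^i ∧ δy^j` on `TM`, computed at each point in the preferred chart. -/
def Omega1 (p : TangentBundle (𝓡 n) M) : TangentSpace (𝓡 n).tangent p [⋀^Fin 2]→L[ℝ] ℝ :=
  Omega1In g (chartAt (EuclideanSpace ℝ (Fin n)) p.proj) p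

/-- The 1-form `η₁ = g_{ij} y^i dx^j` on `TM`, computed at each point in the preferred chart. -/
def eta1 (p : TangentBundle (𝓡 n) M) : TangentSpace (𝓡 n).tangent p [⋀^Fin 1]→L[ℝ] ℝ :=
  eta1In g (chartAt (EuclideanSpace ℝ (Fin n)) p.proj) p

end Metric

end GeomDyn

end

/-! The form `η₁` is the Liouville form of the cotangent bundle carried to `TM` by the metric: it
sends a tangent vector `w` at `(x, y)` to `g_x(y, dπ w)`, where `π : TM → M` is the projection. This
description mentions no chart. In the coordinates `(x, y)` it is the pullback of `tautForm`, whose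
exterior derivative is explicit (`extDeriv_tautForm_apply`).

The Christoffel symbols enter through the Koszul identity `g(Γ(u,v),w) = (1/2)(D_u g(v,w) + D_v
g(u,w) - D_w g(u,v))` (`metricForm_christoffelVec`). It turns `g_{ij} dx^i ∧ δy^j` into minus the
exterior derivative of the tautological form (`Omega1In_eq`). Since `d` commutes with pullback by
the transition maps, chart independence passes from `η₁` to `Ω₁`. Closedness is `d ∘ d = 0`.
Nondegeneracy comes from that of `g`, as `(dx, dy) ↦ (dx, δy)` is invertible.

For the dynamics, the Koszul identity gives `Ω₁(u, ·) = dH` as soon as `u` has coordinates `(y, grad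
f - Γ(y,y))` (`Omega1_apply_of_hamiltonVec`), and nondegeneracy makes such a `u` unique. The
Hamilton equations are therefore `x' = y`, `y' + Γ(y,y) = grad f`: the first half says that the
curve is the lift of its projection, the second that `∇x'/dt = grad f`. -/

noncomputable section

namespace GeomDyn

/-! ### The tautological 1-form on a product and its exterior derivative. -/

section Taut

variable {E : Type*} [NormedAddCommGroup E] [NormedSpace ℝ E]

/-- The 1-form `(a, b) ↦ G_x(y, a)` at the point `(x, y)` of `E × E`, for a field `G` of bilinear
forms on `E`. -/
def tautForm (G : E → E →L[ℝ] E →L[ℝ] ℝ) (z : E × E) : (E × E) [⋀^Fin 1]→L[ℝ] ℝ :=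
  ContinuousAlternatingMap.ofSubsingleton ℝ (E × E) ℝ (0 : Fin 1)
    ((G z.1 z.2).comp (ContinuousLinearMap.fst ℝ E E))

theorem tautForm_apply (G : E → E →L[ℝ] E →L[ℝ] ℝ) (z : E × E) (v : Fin 1 → E × E) :
    tautForm G z v = G z.1 z.2 (v 0).1 := rfl

theorem contDiffAt_tautForm {G : E → E →L[ℝ] E →L[ℝ] ℝ} {z : E × E}
    (hG : ContDiffAt ℝ ∞ G z.1) : ContDiffAt ℝ ∞ (tautForm G) z := by
  have h1 : ContDiffAt ℝ ∞ (fun z : E × E => G z.1) z := hG.comp z contDiffAt_fst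
  have h2 : ContDiffAt ℝ ∞
      (fun z : E × E => (G z.1 z.2).comp (ContinuousLinearMap.fst ℝ E E)) z :=
    (h1.clm_apply contDiffAt_snd).clm_comp contDiffAt_const
  exact (LinearIsometryEquiv.contDiff (ContinuousAlternatingMap.ofSubsingletonLIE
    (𝕜 := ℝ) (E := E × E) (F := ℝ) (0 : Fin 1))).contDiffAt.comp z h2

theorem contDiffAt_extDeriv {k : ℕ} {α : E → E [⋀^Fin k]→L[ℝ] ℝ} {z : E}
    (hα : ContDiffAt ℝ ∞ α z) : ContDiffAt ℝ ∞ (extDeriv α) z :=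
  ContDiffAt.comp (g := ContinuousAlternatingMap.alternatizeUncurryFinCLM ℝ E ℝ (n := k))
    (f := fderiv ℝ α) z (ContinuousLinearMap.contDiff _).contDiffAt
    (hα.fderiv_right (m := ∞) (by simp))

/-- With `w` constant, the product rule differentiates `G_x(y, w.1)` through `x` and through `y`;
antisymmetrizing the two contributions gives the formula. -/
theorem extDeriv_tautForm_apply {G : E → E →L[ℝ] E →L[ℝ] ℝ} {z : E × E}
    (hG : ContDiffAt ℝ ∞ G z.1) (u v : E × E) :
    extDeriv (tautForm G) z ![u, v] =
      (fderiv ℝ G z.1 u.1 z.2 v.1 + G z.1 u.2 v.1) -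
        (fderiv ℝ G z.1 v.1 z.2 u.1 + G z.1 v.2 u.1) := by
  have hd : ∀ u w : E × E, fderiv ℝ (fun z : E × E => G z.1 z.2 w.1) z u =
      fderiv ℝ G z.1 u.1 z.2 w.1 + G z.1 u.2 w.1 := by
    intro u w
    have h0 : HasFDerivAt G (fderiv ℝ G z.1) z.1 :=
      (hG.differentiableAt (by simp)).hasFDerivAt
    have hf : HasFDerivAt (fun z : E × E => z.1) (ContinuousLinearMap.fst ℝ E E) z :=
      hasFDerivAt_fst
    have h1 := HasFDerivAt.comp (G := E →L[ℝ] E →L[ℝ] ℝ) (f := fun z : E × E => z.1) z h0 hf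
    have h2 := h1.clm_apply (hasFDerivAt_snd (𝕜 := ℝ) (E := E) (F := E) (p := z))
    have h3 := h2.clm_apply (hasFDerivAt_const w.1 z)
    have h4 := congrArg (fun L => L u) h3.fderiv
    simpa [add_comm] using h4
  rw [extDeriv_apply ((contDiffAt_tautForm hG).differentiableAt (by simp))]
  rw [Fin.sum_univ_two]
  simp only [tautForm_apply]
  -- The exterior derivative is an alternating sum in which the removed vector becomes the direction
  -- of differentiation.
  have e0 : Fin.removeNth 0 ![u, v] 0 = v := rfl
  have e1 : Fin.removeNth 1 ![u, v] 0 = u := rfl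
  rw [e0, e1, hd, hd]
  simp [sub_eq_add_neg, add_comm]

end Taut

/-- Nondegeneracy is injectivity of `B : E → E*`, and `E` and `E*` have the same finite dimension.
-/
theorem isInvertible_of_nondegenerate {E : Type*} [NormedAddCommGroup E] [NormedSpace ℝ E]
    [FiniteDimensional ℝ E] {B : E →L[ℝ] E →L[ℝ] ℝ}
    (hB : ∀ u, (∀ v, B u v = 0) → u = 0) : B.IsInvertible := by
  have hinj : Function.Injective B.toLinearMap :=
    (injective_iff_map_eq_zero _).2 fun u hu => hB u fun v => congrArg (fun L => L v) hu
  have hdim : Module.finrank ℝ E = Module.finrank ℝ (E →L[ℝ] ℝ) := by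
    rw [← (LinearMap.toContinuousLinearMap (𝕜 := ℝ) (E := E) (F' := ℝ)).finrank_eq]
    exact (Subspace.dual_finrank_eq (K := ℝ) (V := E)).symm
  exact ⟨(LinearEquiv.ofInjectiveOfFinrankEq _ hinj hdim).toContinuousLinearEquiv, rfl⟩

/-! ### The metric read in a chart. -/

section MetricForm

variable {n r s : ℕ} {M : Type*} [TopologicalSpace M]
  [ChartedSpace (EuclideanSpace ℝ (Fin n)) M] [IsManifold (𝓡 n) ∞ M]
  (g : SemiRiemannianMetric n r s M)
  (e : OpenPartialHomeomorph M (EuclideanSpace ℝ (Fin n)))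

theorem euclidean_eq_sum (u : EuclideanSpace ℝ (Fin n)) :
    u = ∑ i, u i • EuclideanSpace.single i (1 : ℝ) := by
  ext k
  simp [Pi.single_apply, Finset.sum_apply]

/-- The metric in the chart `e`, as a field of bilinear forms on the model space. -/
def metricForm (z : EuclideanSpace ℝ (Fin n)) :
    EuclideanSpace ℝ (Fin n) →L[ℝ] EuclideanSpace ℝ (Fin n) →L[ℝ] ℝ :=
  ∑ i, ∑ j, metricComp g e i j z •
    ContinuousLinearMap.smulRight (EuclideanSpace.proj i : EuclideanSpace ℝ (Fin n) →L[ℝ] ℝ)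
      (EuclideanSpace.proj j : EuclideanSpace ℝ (Fin n) →L[ℝ] ℝ)

theorem metricForm_apply (z u v : EuclideanSpace ℝ (Fin n)) :
    metricForm g e z u v = ∑ i, ∑ j, metricComp g e i j z * u i * v j := by
  simp [metricForm, mul_assoc]

/-- Only bilinearity is used, so `z` need not lie in the target of the chart. -/
theorem metricForm_eq (z u v : EuclideanSpace ℝ (Fin n)) :
    metricForm g e z u v =
      g.val (e.symm z) (mfderiv (𝓡 n) (𝓡 n) e.symm z u) (mfderiv (𝓡 n) (𝓡 n) e.symm z v) := by
  have h : ∀ u : EuclideanSpace ℝ (Fin n), mfderiv (𝓡 n) (𝓡 n) e.symm z u =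
      ∑ i, u i • mfderiv (𝓡 n) (𝓡 n) e.symm z (EuclideanSpace.single i (1 : ℝ)) := by
    intro u
    have h1 := congrArg (mfderiv (𝓡 n) (𝓡 n) e.symm z) (euclidean_eq_sum u)
    refine h1.trans ?_
    refine (map_sum (mfderiv (𝓡 n) (𝓡 n) e.symm z) _ _).trans ?_
    exact Finset.sum_congr rfl fun i _ => map_smul (mfderiv (𝓡 n) (𝓡 n) e.symm z) _ _
  rw [metricForm_apply, h u, h v]
  have hB : ∀ (x : M) (a b : Fin n → TangentSpace (𝓡 n) x),
      g.val x (∑ i, u i • a i) (∑ j, v j • b j) =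
        ∑ i, ∑ j, g.val x (a i) (b j) * u i * v j := by
    intro x a b
    simp only [map_sum, map_smul, sum_apply, smul_apply,
      smul_eq_mul, Finset.mul_sum]
    rw [Finset.sum_comm]
    exact Finset.sum_congr rfl fun i _ => Finset.sum_congr rfl fun j _ => by ring
  exact (hB _ _ _).symm

theorem metricForm_symm (z u v : EuclideanSpace ℝ (Fin n)) :
    metricForm g e z u v = metricForm g e z v u := by
  rw [metricForm_eq, metricForm_eq, g.symm]

theorem metricComp_eq (i j : Fin n) (z : EuclideanSpace ℝ (Fin n)) :
    metricComp g e i j z =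
      metricForm g e z (EuclideanSpace.single i (1 : ℝ)) (EuclideanSpace.single j (1 : ℝ)) := by
  rw [metricForm_eq, metricComp]

variable {e}

omit [IsManifold (𝓡 n) ∞ M] in
theorem mdifferentiable_of_mem (he : e ∈ IsManifold.maximalAtlas (𝓡 n) ∞ M) :
    e.MDifferentiable (𝓡 n) (𝓡 n) :=
  ⟨(contMDiffOn_of_mem_maximalAtlas he).mdifferentiableOn (by simp),
    (contMDiffOn_symm_of_mem_maximalAtlas he).mdifferentiableOn (by simp)⟩

theorem metricForm_nondegenerate (he : e ∈ IsManifold.maximalAtlas (𝓡 n) ∞ M)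
    {z : EuclideanSpace ℝ (Fin n)} (hz : z ∈ e.target) (u : EuclideanSpace ℝ (Fin n))
    (hu : ∀ v, metricForm g e z u v = 0) : u = 0 := by
  have hm := (mdifferentiable_of_mem he).symm
  refine (injective_iff_map_eq_zero' (mfderiv (𝓡 n) (𝓡 n) e.symm z)).1
    (hm.mfderiv_injective hz) u |>.1 (g.nondegenerate _ _ fun w => ?_)
  obtain ⟨v, rfl⟩ := hm.mfderiv_surjective hz w
  exact (metricForm_eq g e z u v).symm.trans (hu v)

/-- The coordinate fields are the tangent map of `e.symm` applied to constant fields, hence smooth;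
pairing them by the smooth tensor `g` keeps smoothness. -/
theorem contDiffOn_metricComp (he : e ∈ IsManifold.maximalAtlas (𝓡 n) ∞ M) (i j : Fin n) :
    ContDiffOn ℝ ∞ (metricComp g e i j) e.target := by
  rw [← contMDiffOn_iff_contDiffOn]
  have hs := contMDiffOn_symm_of_mem_maximalAtlas he
  have hT := hs.contMDiffOn_tangentMapWithin (m := ∞) (by simp)
    e.open_target.uniqueMDiffOn
  have hv : ∀ k : Fin n, ContMDiffOn (𝓡 n) (𝓡 n).tangent ∞
      (fun z => (⟨e.symm z, mfderiv (𝓡 n) (𝓡 n) e.symm z (EuclideanSpace.single k (1 : ℝ))⟩ :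
        TangentBundle (𝓡 n) M)) e.target := by
    intro k
    have hc : ContMDiffOn (𝓡 n) (𝓡 n).tangent ∞
        (fun z : EuclideanSpace ℝ (Fin n) => (⟨z, EuclideanSpace.single k (1 : ℝ)⟩ :
          TangentBundle (𝓡 n) (EuclideanSpace ℝ (Fin n)))) e.target :=
      contMDiffOn_vectorSpace_iff_contDiffOn.2 contDiffOn_const
    refine (hT.comp hc fun z hz => hz).congr fun z hz => ?_
    simp only [Function.comp_apply, tangentMapWithin]
    rw [mfderivWithin_of_isOpen e.open_target hz]
  have hb : ContMDiffOn (𝓡 n) ((𝓡 n).prod 𝓘(ℝ)) ∞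
      (fun z => Bundle.TotalSpace.mk' ℝ (E := Bundle.Trivial M ℝ) (e.symm z)
        (metricComp g e i j z)) e.target := by
    refine ContMDiffOn.clm_bundle_apply₂ (F₁ := EuclideanSpace ℝ (Fin n))
      (F₂ := EuclideanSpace ℝ (Fin n)) ?_ (hv i) (hv j)
    exact g.contMDiff.comp_contMDiffOn hs
  intro z hz
  -- In the trivial line bundle a section is smooth exactly when its base and fibre components are;
  -- the fibre component is `g_{ij}`.
  have := hb z hz
  simp only [Bundle.contMDiffWithinAt_totalSpace] at this
  exact this.2

theorem contDiffOn_metricForm (he : e ∈ IsManifold.maximalAtlas (𝓡 n) ∞ M) :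
    ContDiffOn ℝ ∞ (metricForm g e) e.target := by
  refine ContDiffOn.sum fun i _ => ContDiffOn.sum fun j _ => ?_
  let A : EuclideanSpace ℝ (Fin n) →L[ℝ] EuclideanSpace ℝ (Fin n) →L[ℝ] ℝ :=
    ContinuousLinearMap.smulRight (EuclideanSpace.proj i : EuclideanSpace ℝ (Fin n) →L[ℝ] ℝ)
      (EuclideanSpace.proj j : EuclideanSpace ℝ (Fin n) →L[ℝ] ℝ)
  have hA : ContDiff ℝ ∞ fun c : ℝ => c • A :=
    ContinuousLinearMap.contDiff
      (F := EuclideanSpace ℝ (Fin n) →L[ℝ] EuclideanSpace ℝ (Fin n) →L[ℝ] ℝ)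
      ((ContinuousLinearMap.id ℝ ℝ).smulRight A)
  exact hA.comp_contDiffOn (contDiffOn_metricComp g he i j)

theorem contDiffAt_metricForm (he : e ∈ IsManifold.maximalAtlas (𝓡 n) ∞ M)
    {z : EuclideanSpace ℝ (Fin n)} (hz : z ∈ e.target) : ContDiffAt ℝ ∞ (metricForm g e) z :=
  (contDiffOn_metricForm g he).contDiffAt (e.open_target.mem_nhds hz)

theorem isInvertible_metricForm (he : e ∈ IsManifold.maximalAtlas (𝓡 n) ∞ M)
    {z : EuclideanSpace ℝ (Fin n)} (hz : z ∈ e.target) : (metricForm g e z).IsInvertible :=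
  isInvertible_of_nondegenerate fun u hu => metricForm_nondegenerate g he hz u hu

theorem fderiv_metricForm_apply (he : e ∈ IsManifold.maximalAtlas (𝓡 n) ∞ M)
    {z : EuclideanSpace ℝ (Fin n)} (hz : z ∈ e.target) (u v w : EuclideanSpace ℝ (Fin n)) :
    fderiv ℝ (metricForm g e) z u v w =
      ∑ i, ∑ j, (∑ h, u h * partialDeriv h (metricComp g e i j) z) * v i * w j := by
  have hd : HasFDerivAt (metricForm g e) (fderiv ℝ (metricForm g e) z) z :=
    ((contDiffAt_metricForm g he hz).differentiableAt (by simp)).hasFDerivAt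
  have h1 := (hd.clm_apply (hasFDerivAt_const v z)).clm_apply (hasFDerivAt_const w z)
  have h2 : HasFDerivAt (fun z => metricForm g e z v w)
      (∑ i, ∑ j, (v i * w j) • fderiv ℝ (metricComp g e i j) z) z := by
    have : (fun z => metricForm g e z v w) =
        fun z => ∑ i, ∑ j, metricComp g e i j z * (v i * w j) := by
      funext z
      simp only [metricForm_apply, mul_assoc]
    rw [this]
    refine HasFDerivAt.fun_sum fun i _ => HasFDerivAt.fun_sum fun j _ => ?_
    exact (((contDiffOn_metricComp g he i j).contDiffAt
      (e.open_target.mem_nhds hz)).differentiableAt (by simp)).hasFDerivAt.mul_const _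
  have h3 := congrArg (fun L => L u) (h1.unique h2)
  have h4 : ∀ i j, fderiv ℝ (metricComp g e i j) z u =
      ∑ h, u h * partialDeriv h (metricComp g e i j) z := by
    intro i j
    conv_lhs => rw [euclidean_eq_sum u]
    simp [partialDeriv]
  simp at h3
  rw [h3]
  refine Finset.sum_congr rfl fun i _ => Finset.sum_congr rfl fun j _ => ?_
  rw [h4]
  ring

end MetricForm

/-! ### Christoffel symbols and the Koszul identity. -/

section Christoffel

variable {n r s : ℕ} {M : Type*} [TopologicalSpace M]
  [ChartedSpace (EuclideanSpace ℝ (Fin n)) M] [IsManifold (𝓡 n) ∞ M]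
  (g : SemiRiemannianMetric n r s M)
  {e : OpenPartialHomeomorph M (EuclideanSpace ℝ (Fin n))}

theorem metricComp_symm (i j : Fin n) (z : EuclideanSpace ℝ (Fin n)) :
    metricComp g e i j z = metricComp g e j i z := by
  rw [metricComp_eq, metricComp_eq, metricForm_symm]

variable (e) in
/-- The vector `Γ(u, v)` with components `Γ^k_{ij} u^i v^j`. -/
def christoffelVec (z u v : EuclideanSpace ℝ (Fin n)) : EuclideanSpace ℝ (Fin n) :=
  WithLp.toLp 2 fun k => ∑ i, ∑ j, christoffel g e k i j z * u i * v j

/-- Needed because `christoffel` contains a matrix inverse, which is meaningful only for an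
invertible matrix. A vector killed by the matrix is orthogonal to everything. -/
theorem isUnit_metricMatrix (he : e ∈ IsManifold.maximalAtlas (𝓡 n) ∞ M)
    {z : EuclideanSpace ℝ (Fin n)} (hz : z ∈ e.target) :
    IsUnit (Matrix.of fun a b => metricComp g e a b z) := by
  rw [← Matrix.mulVec_injective_iff_isUnit]
  intro x y hxy
  have h := metricForm_nondegenerate g he hz (WithLp.toLp 2 x - WithLp.toLp 2 y) fun v => by
    rw [metricForm_symm, metricForm_apply]
    refine Finset.sum_eq_zero fun i _ => ?_
    have := congrFun hxy i
    simp only [Matrix.mulVec, dotProduct, Matrix.of_apply] at this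
    have h2 : ∑ j, metricComp g e i j z * (x j - y j) = 0 := by
      simp only [mul_sub, Finset.sum_sub_distrib, this, sub_self]
    calc ∑ j, metricComp g e i j z * v i * (WithLp.toLp 2 x - WithLp.toLp 2 y) j
        = v i * ∑ j, metricComp g e i j z * (x j - y j) := by
          rw [Finset.mul_sum]
          exact Finset.sum_congr rfl fun j _ => by simp; ring
      _ = 0 := by rw [h2, mul_zero]
  funext i
  have h3 := congrArg (fun w : EuclideanSpace ℝ (Fin n) => w i) h
  simpa [sub_eq_zero] using h3

/-- Lowering the index undoes the raising in the definition: `A (A⁻¹ T) = T` for the Gram matrix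
`A`. -/
theorem sum_metricComp_mul_christoffel (he : e ∈ IsManifold.maximalAtlas (𝓡 n) ∞ M)
    {z : EuclideanSpace ℝ (Fin n)} (hz : z ∈ e.target) (i j l : Fin n) :
    ∑ a, metricComp g e a l z * christoffel g e a i j z =
      (1 / 2) * (partialDeriv i (metricComp g e j l) z + partialDeriv j (metricComp g e i l) z
        - partialDeriv l (metricComp g e i j) z) := by
  set A : Matrix (Fin n) (Fin n) ℝ := Matrix.of fun a b => metricComp g e a b z with hA
  set T : Fin n → ℝ := fun l => partialDeriv i (metricComp g e j l) z +
    partialDeriv j (metricComp g e i l) z - partialDeriv l (metricComp g e i j) z with hT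
  have hdet : IsUnit A.det := (Matrix.isUnit_iff_isUnit_det A).1 (isUnit_metricMatrix g he hz)
  have h1 : (A * A⁻¹).mulVec T l = T l := by rw [Matrix.mul_nonsing_inv A hdet, Matrix.one_mulVec]
  rw [← Matrix.mulVec_mulVec] at h1
  calc ∑ a, metricComp g e a l z * christoffel g e a i j z
      = (1 / 2) * A.mulVec (A⁻¹.mulVec T) l := by
        rw [Matrix.mulVec, dotProduct, Finset.mul_sum]
        refine Finset.sum_congr rfl fun a _ => ?_
        rw [metricComp_symm, christoffel]
        simp only [Matrix.mulVec, dotProduct, hA, hT, Matrix.of_apply]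
        ring
    _ = _ := by rw [h1]

/-- The Koszul formula for coordinate fields, whose brackets vanish. Every later link between `Γ`
and the metric rests on it. -/
theorem metricForm_christoffelVec (he : e ∈ IsManifold.maximalAtlas (𝓡 n) ∞ M)
    {z : EuclideanSpace ℝ (Fin n)} (hz : z ∈ e.target) (u v w : EuclideanSpace ℝ (Fin n)) :
    metricForm g e z (christoffelVec g e z u v) w =
      (1 / 2) * (fderiv ℝ (metricForm g e) z u v w + fderiv ℝ (metricForm g e) z v u w -
        fderiv ℝ (metricForm g e) z w u v) := by
  -- All four terms are brought to sums over `l, i, j` against the same monomial `u i * v j * w l`,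
  -- so that they can be compared coefficientwise.
  have hL : metricForm g e z (christoffelVec g e z u v) w =
      ∑ l, ∑ i, ∑ j, (∑ a, metricComp g e a l z * christoffel g e a i j z) *
        (u i * v j * w l) := by
    rw [metricForm_apply, Finset.sum_comm]
    refine Finset.sum_congr rfl fun l _ => ?_
    simp only [christoffelVec, Finset.mul_sum, Finset.sum_mul]
    rw [Finset.sum_comm]
    refine Finset.sum_congr rfl fun i _ => ?_
    rw [Finset.sum_comm]
    refine Finset.sum_congr rfl fun j _ => Finset.sum_congr rfl fun a _ => ?_
    ring
  have h1 : fderiv ℝ (metricForm g e) z u v w =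
      ∑ l, ∑ i, ∑ j, partialDeriv i (metricComp g e j l) z * (u i * v j * w l) := by
    rw [fderiv_metricForm_apply g he hz, Finset.sum_comm]
    refine Finset.sum_congr rfl fun l _ => ?_
    rw [Finset.sum_comm (γ := Fin n)]
    refine Finset.sum_congr rfl fun j _ => ?_
    simp only [Finset.sum_mul]
    refine Finset.sum_congr rfl fun i _ => ?_
    ring
  have h2 : fderiv ℝ (metricForm g e) z v u w =
      ∑ l, ∑ i, ∑ j, partialDeriv j (metricComp g e i l) z * (u i * v j * w l) := by
    rw [fderiv_metricForm_apply g he hz, Finset.sum_comm]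
    refine Finset.sum_congr rfl fun l _ => Finset.sum_congr rfl fun i _ => ?_
    simp only [Finset.sum_mul]
    refine Finset.sum_congr rfl fun j _ => ?_
    ring
  have h3 : fderiv ℝ (metricForm g e) z w u v =
      ∑ l, ∑ i, ∑ j, partialDeriv l (metricComp g e i j) z * (u i * v j * w l) := by
    rw [fderiv_metricForm_apply g he hz]
    conv_rhs => rw [Finset.sum_comm]
    refine Finset.sum_congr rfl fun i _ => ?_
    conv_rhs => rw [Finset.sum_comm]
    refine Finset.sum_congr rfl fun j _ => ?_
    simp only [Finset.sum_mul]
    refine Finset.sum_congr rfl fun l _ => ?_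
    ring
  rw [hL, h1, h2, h3]
  simp only [← Finset.sum_add_distrib, ← Finset.sum_sub_distrib, Finset.mul_sum]
  refine Finset.sum_congr rfl fun l _ => Finset.sum_congr rfl fun i _ =>
    Finset.sum_congr rfl fun j _ => ?_
  rw [sum_metricComp_mul_christoffel g he hz]
  ring

/-- This form without components yields the smoothness of `Γ(y,y)` from that of operator inversion.
-/
theorem christoffelVec_eq (he : e ∈ IsManifold.maximalAtlas (𝓡 n) ∞ M)
    {z : EuclideanSpace ℝ (Fin n)} (hz : z ∈ e.target) (u v : EuclideanSpace ℝ (Fin n)) :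
    christoffelVec g e z u v = (metricForm g e z).inverse
      ((1 / 2 : ℝ) • (fderiv ℝ (metricForm g e) z u v + fderiv ℝ (metricForm g e) z v u -
        ((fderiv ℝ (metricForm g e) z).flip u).flip v)) := by
  refine ((isInvertible_metricForm g he hz).inverse_apply_eq.2 ?_).symm
  ext w
  rw [metricForm_christoffelVec g he hz]
  simp

end Christoffel

/-! ### The chart of `TM` induced by a chart of `M`. -/

section TangentChart

variable {n : ℕ} {M : Type*} [TopologicalSpace M]
  [ChartedSpace (EuclideanSpace ℝ (Fin n)) M] [IsManifold (𝓡 n) ∞ M]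
  {e : OpenPartialHomeomorph M (EuclideanSpace ℝ (Fin n))}

variable (e) in
/-- The coordinates `(x, y)` on `TM` induced by the chart `e` of `M`. -/
def tangentCoord (p : TangentBundle (𝓡 n) M) :
    EuclideanSpace ℝ (Fin n) × EuclideanSpace ℝ (Fin n) :=
  (e p.proj, NormedSpace.fromTangentSpace (𝕜 := ℝ) (e p.proj)
    (mfderiv (𝓡 n) (𝓡 n) e p.proj p.snd))

variable (e) in
/-- The tangent vector with given coordinates `(x, y)` in the chart `e`. -/
def tangentCoordSymm (z : EuclideanSpace ℝ (Fin n) × EuclideanSpace ℝ (Fin n)) :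
    TangentBundle (𝓡 n) M :=
  ⟨e.symm z.1, mfderiv (𝓡 n) (𝓡 n) e.symm z.1 z.2⟩

theorem contMDiffOn_tangentCoord (he : e ∈ IsManifold.maximalAtlas (𝓡 n) ∞ M) :
    ContMDiffOn (𝓡 n).tangent
      𝓘(ℝ, EuclideanSpace ℝ (Fin n) × EuclideanSpace ℝ (Fin n)) ∞ (tangentCoord e)
      ((fun p : TangentBundle (𝓡 n) M => p.proj) ⁻¹' e.source) := by
  have hs := contMDiffOn_of_mem_maximalAtlas he
  refine ContMDiffOn.prodMk_space ?_ ?_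
  · exact hs.comp (Bundle.contMDiff_proj (TangentSpace (𝓡 n))).contMDiffOn fun p hp => hp
  · have hT := hs.contMDiffOn_tangentMapWithin (m := ∞) (by simp) e.open_source.uniqueMDiffOn
    have h2 := (contMDiff_snd_tangentBundle_modelSpace (EuclideanSpace ℝ (Fin n))
      (𝓡 n) (n := ∞)).comp_contMDiffOn hT
    refine h2.congr fun p hp => ?_
    exact congrArg (fun L : TangentSpace (𝓡 n) p.proj →L[ℝ] TangentSpace (𝓡 n) (e p.proj) =>
      L p.snd) (mfderivWithin_of_isOpen (I' := 𝓡 n) (f := e) e.open_source hp).symm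

theorem contMDiffOn_tangentCoordSymm (he : e ∈ IsManifold.maximalAtlas (𝓡 n) ∞ M) :
    ContMDiffOn 𝓘(ℝ, EuclideanSpace ℝ (Fin n) × EuclideanSpace ℝ (Fin n)) (𝓡 n).tangent
      ∞ (tangentCoordSymm e) (Prod.fst ⁻¹' e.target) := by
  have hs := contMDiffOn_symm_of_mem_maximalAtlas he
  have hT := hs.contMDiffOn_tangentMapWithin (m := ∞) (by simp) e.open_target.uniqueMDiffOn
  have hc : ContMDiff 𝓘(ℝ, EuclideanSpace ℝ (Fin n) × EuclideanSpace ℝ (Fin n))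
      (𝓡 n).tangent ∞
      (fun z : EuclideanSpace ℝ (Fin n) × EuclideanSpace ℝ (Fin n) => (⟨z.1, z.2⟩ :
          TangentBundle (𝓡 n) (EuclideanSpace ℝ (Fin n)))) := by
    intro z
    apply Bundle.contMDiffAt_totalSpace.2
    refine ⟨contDiff_fst.contMDiff.contMDiffAt, ?_⟩
    convert! (contDiff_snd (𝕜 := ℝ) (n := ∞) (E := EuclideanSpace ℝ (Fin n))
      (F := EuclideanSpace ℝ (Fin n))).contMDiff.contMDiffAt with y
    simp
    rfl
  refine (hT.comp hc.contMDiffOn fun z hz => hz).congr fun z hz => ?_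
  simp only [Function.comp_apply, tangentMapWithin]
  rw [mfderivWithin_of_isOpen e.open_target hz]
  rfl

/-- The chart of `TM` induced by a chart of `M`. -/
def tangentChart (he : e ∈ IsManifold.maximalAtlas (𝓡 n) ∞ M) :
    OpenPartialHomeomorph (TangentBundle (𝓡 n) M)
      (EuclideanSpace ℝ (Fin n) × EuclideanSpace ℝ (Fin n)) where
  toFun := tangentCoord e
  invFun := tangentCoordSymm e
  source := (fun p : TangentBundle (𝓡 n) M => p.proj) ⁻¹' e.source
  target := Prod.fst ⁻¹' e.target
  map_source' p hp := e.map_source hp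
  map_target' z hz := e.map_target hz
  left_inv' := by
    rintro ⟨x, v⟩ (hx : x ∈ e.source)
    have h := congrArg (fun L => L v) ((mdifferentiable_of_mem he).symm_comp_deriv hx)
    -- The two vectors live in fibres over points that are equal only propositionally; generalizing
    -- both base point and vector allows substitution. The same device recurs below.
    have h2 : ∀ (x' : M) (w : EuclideanSpace ℝ (Fin n)), x' = x → w = v →
        (⟨x', w⟩ : TangentBundle (𝓡 n) M) = ⟨x, v⟩ := by
      rintro x' w rfl rfl
      rfl
    exact h2 _ _ (e.left_inv hx) h
  right_inv' := by
    rintro ⟨x, v⟩ (hx : x ∈ e.target)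
    have h := congrArg (fun L => L v) ((mdifferentiable_of_mem he).comp_symm_deriv hx)
    exact Prod.ext (e.right_inv hx) h
  open_source := e.open_source.preimage (FiberBundle.continuous_proj _ _)
  open_target := e.open_target.preimage continuous_fst
  continuousOn_toFun := (contMDiffOn_tangentCoord he).continuousOn
  continuousOn_invFun := (contMDiffOn_tangentCoordSymm he).continuousOn

theorem mdifferentiable_tangentChart (he : e ∈ IsManifold.maximalAtlas (𝓡 n) ∞ M) :
    (tangentChart he).MDifferentiable (𝓡 n).tangent
      𝓘(ℝ, EuclideanSpace ℝ (Fin n) × EuclideanSpace ℝ (Fin n)) :=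
  ⟨(contMDiffOn_tangentCoord he).mdifferentiableOn (by simp),
    (contMDiffOn_tangentCoordSymm he).mdifferentiableOn (by simp)⟩

theorem mem_maximalAtlas_chartAt (x : M) :
    chartAt (EuclideanSpace ℝ (Fin n)) x ∈ IsManifold.maximalAtlas (𝓡 n) ∞ M :=
  IsManifold.chart_mem_maximalAtlas x

theorem extChartAt_source_eq (p : TangentBundle (𝓡 n) M) :
    (extChartAt (𝓡 n).tangent p).source =
      (tangentChart (mem_maximalAtlas_chartAt p.proj)).source := by
  rw [extChartAt_source]
  ext q
  simp [tangentChart]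

/-- The preferred chart of `TM` at `p` is the tangent map of the preferred chart of `M` at `p.proj`.
The agreement is stated on the source only. -/
theorem extChartAt_eqOn (p : TangentBundle (𝓡 n) M) :
    EqOn (extChartAt (𝓡 n).tangent p) (tangentChart (mem_maximalAtlas_chartAt p.proj))
      (extChartAt (𝓡 n).tangent p).source := by
  intro q hq
  rw [extChartAt_source_eq] at hq
  have h := tangentMap_chart (I := 𝓡 n) (p := p) (q := q) hq
  exact (congrArg (Bundle.TotalSpace.toProd _ _) h).symm

theorem extChartAt_target_eq (p : TangentBundle (𝓡 n) M) :
    (extChartAt (𝓡 n).tangent p).target =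
      (tangentChart (mem_maximalAtlas_chartAt p.proj)).target := by
  rw [← PartialEquiv.image_source_eq_target, (extChartAt_eqOn p).image_eq, extChartAt_source_eq,
    OpenPartialHomeomorph.image_source_eq_target]

theorem extChartAt_symm_eqOn (p : TangentBundle (𝓡 n) M) :
    EqOn (extChartAt (𝓡 n).tangent p).symm
      (tangentChart (mem_maximalAtlas_chartAt p.proj)).symm
      (extChartAt (𝓡 n).tangent p).target := by
  intro z hz
  have hs := (extChartAt (𝓡 n).tangent p).map_target hz
  have h := extChartAt_eqOn p hs
  rw [(extChartAt (𝓡 n).tangent p).right_inv hz] at h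
  rw [extChartAt_source_eq] at hs
  conv_rhs => rw [h]
  rw [OpenPartialHomeomorph.left_inv _ hs]

end TangentChart

/-! ### The two forms in induced coordinates. -/

section LocalForms

variable {n r s : ℕ} {M : Type*} [TopologicalSpace M]
  [ChartedSpace (EuclideanSpace ℝ (Fin n)) M] [IsManifold (𝓡 n) ∞ M]
  (g : SemiRiemannianMetric n r s M)
  {e : OpenPartialHomeomorph M (EuclideanSpace ℝ (Fin n))}

variable (e) in
/-- The derivative at `p` of the coordinates `(x, y)` on `TM`. -/
def tangentCoordDeriv (p : TangentBundle (𝓡 n) M) :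
    TangentSpace (𝓡 n).tangent p →L[ℝ] EuclideanSpace ℝ (Fin n) × EuclideanSpace ℝ (Fin n) :=
  mfderiv (𝓡 n).tangent 𝓘(ℝ, EuclideanSpace ℝ (Fin n) × EuclideanSpace ℝ (Fin n))
    (tangentCoord e) p

theorem mdifferentiableAt_tangentCoord (he : e ∈ IsManifold.maximalAtlas (𝓡 n) ∞ M)
    {p : TangentBundle (𝓡 n) M} (hp : p.proj ∈ e.source) :
    MDifferentiableAt (𝓡 n).tangent
      𝓘(ℝ, EuclideanSpace ℝ (Fin n) × EuclideanSpace ℝ (Fin n)) (tangentCoord e) p :=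
  (mdifferentiable_tangentChart he).mdifferentiableAt (x := p) hp

theorem mfderiv_clm_comp_tangentCoord (he : e ∈ IsManifold.maximalAtlas (𝓡 n) ∞ M)
    {p : TangentBundle (𝓡 n) M} (hp : p.proj ∈ e.source)
    (L : EuclideanSpace ℝ (Fin n) × EuclideanSpace ℝ (Fin n) →L[ℝ] ℝ) :
    mfderiv (𝓡 n).tangent 𝓘(ℝ, ℝ) (fun q => L (tangentCoord e q)) p =
      L.comp (tangentCoordDeriv e p) := by
  have h := (mdifferentiableAt_tangentCoord he hp).hasMFDerivAt
  have hL := (L.hasMFDerivAt (x := tangentCoord e p))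
  exact (hL.comp p h).mfderiv

theorem dX_apply (he : e ∈ IsManifold.maximalAtlas (𝓡 n) ∞ M)
    {p : TangentBundle (𝓡 n) M} (hp : p.proj ∈ e.source) (i : Fin n)
    (w : TangentSpace (𝓡 n).tangent p) : dX e i p w = (tangentCoordDeriv e p w).1 i :=
  congrArg (fun L => L w) (mfderiv_clm_comp_tangentCoord he hp
    ((EuclideanSpace.proj i : EuclideanSpace ℝ (Fin n) →L[ℝ] ℝ).comp
      (ContinuousLinearMap.fst ℝ _ _)))

theorem dY_apply (he : e ∈ IsManifold.maximalAtlas (𝓡 n) ∞ M)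
    {p : TangentBundle (𝓡 n) M} (hp : p.proj ∈ e.source) (i : Fin n)
    (w : TangentSpace (𝓡 n).tangent p) : dY e i p w = (tangentCoordDeriv e p w).2 i :=
  congrArg (fun L => L w) (mfderiv_clm_comp_tangentCoord he hp
    ((EuclideanSpace.proj i : EuclideanSpace ℝ (Fin n) →L[ℝ] ℝ).comp
      (ContinuousLinearMap.snd ℝ _ _)))

theorem deltaY_apply (he : e ∈ IsManifold.maximalAtlas (𝓡 n) ∞ M)
    {p : TangentBundle (𝓡 n) M} (hp : p.proj ∈ e.source) (j : Fin n)
    (w : TangentSpace (𝓡 n).tangent p) :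
    deltaY g e j p w = ((tangentCoordDeriv e p w).2 +
      christoffelVec g e (tangentCoord e p).1 (tangentCoordDeriv e p w).1
        (tangentCoord e p).2) j := by
  simp only [deltaY, add_apply, sum_apply, smul_apply, smul_eq_mul, dX_apply he hp,
    dY_apply he hp, christoffelVec, PiLp.add_apply]
  refine congrArg _ (Finset.sum_congr rfl fun h _ => Finset.sum_congr rfl fun k _ => ?_)
  simp only [coordY, tangentCoord]
  ring

theorem eta1In_eq (he : e ∈ IsManifold.maximalAtlas (𝓡 n) ∞ M)
    {p : TangentBundle (𝓡 n) M} (hp : p.proj ∈ e.source) :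
    eta1In g e p = (tautForm (metricForm g e) (tangentCoord e p)).compContinuousLinearMap
      (tangentCoordDeriv e p) := by
  ext w
  rw [ContinuousAlternatingMap.compContinuousLinearMap_apply, tautForm_apply, metricForm_apply]
  simp only [eta1In, ContinuousAlternatingMap.ofSubsingleton_apply_apply, sum_apply, smul_apply,
    smul_eq_mul, dX_apply he hp]
  rfl

theorem Omega1In_apply (he : e ∈ IsManifold.maximalAtlas (𝓡 n) ∞ M)
    {p : TangentBundle (𝓡 n) M} (hp : p.proj ∈ e.source)
    (u v : TangentSpace (𝓡 n).tangent p) :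
    Omega1In g e p ![u, v] =
      metricForm g e (tangentCoord e p).1 (tangentCoordDeriv e p u).1
          ((tangentCoordDeriv e p v).2 + christoffelVec g e (tangentCoord e p).1
            (tangentCoordDeriv e p v).1 (tangentCoord e p).2) -
        metricForm g e (tangentCoord e p).1 (tangentCoordDeriv e p v).1
          ((tangentCoordDeriv e p u).2 + christoffelVec g e (tangentCoord e p).1
            (tangentCoordDeriv e p u).1 (tangentCoord e p).2) := by
  rw [metricForm_apply, metricForm_apply, ← Finset.sum_sub_distrib]
  simp only [Omega1In, ContinuousAlternatingMap.sum_apply, ContinuousAlternatingMap.smul_apply,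
    wedge_apply, dX_apply he hp, deltaY_apply g he hp, ← Finset.sum_sub_distrib, smul_eq_mul]
  refine Finset.sum_congr rfl fun i _ => Finset.sum_congr rfl fun j _ => ?_
  simp only [tangentCoord]
  ring

theorem fderiv_metricForm_symm (he : e ∈ IsManifold.maximalAtlas (𝓡 n) ∞ M)
    {z : EuclideanSpace ℝ (Fin n)} (hz : z ∈ e.target) (u v w : EuclideanSpace ℝ (Fin n)) :
    fderiv ℝ (metricForm g e) z u v w = fderiv ℝ (metricForm g e) z u w v := by
  rw [fderiv_metricForm_apply g he hz, fderiv_metricForm_apply g he hz, Finset.sum_comm]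
  refine Finset.sum_congr rfl fun i _ => Finset.sum_congr rfl fun j _ => ?_
  have : metricComp g e i j = metricComp g e j i := funext fun z => metricComp_symm g i j z
  rw [this]
  ring

/-- By the Koszul identity and symmetry, the terms `D_y g` cancel in `g(Γ(v,y),u) - g(Γ(u,y),v)`,
leaving `D_v g(y,u) - D_u g(y,v)`. This is the derivative part of minus the exterior derivative of
`tautForm`. -/
theorem Omega1In_eq (he : e ∈ IsManifold.maximalAtlas (𝓡 n) ∞ M)
    {p : TangentBundle (𝓡 n) M} (hp : p.proj ∈ e.source) :
    Omega1In g e p =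
      (-extDeriv (tautForm (metricForm g e)) (tangentCoord e p)).compContinuousLinearMap
        (tangentCoordDeriv e p) := by
  have hz : (tangentCoord e p).1 ∈ e.target := e.map_source hp
  ext w
  obtain ⟨u, v, rfl⟩ : ∃ u v, w = ![u, v] := ⟨w 0, w 1, by ext i; fin_cases i <;> rfl⟩
  have hc : (fun i => tangentCoordDeriv e p (![u, v] i)) =
      ![tangentCoordDeriv e p u, tangentCoordDeriv e p v] := by
    ext i <;> fin_cases i <;> rfl
  rw [Omega1In_apply g he hp, ContinuousAlternatingMap.compContinuousLinearMap_apply]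
  refine Eq.trans ?_ (congrArg (-extDeriv (tautForm (metricForm g e)) (tangentCoord e p)) hc.symm)
  rw [ContinuousAlternatingMap.neg_apply,
    extDeriv_tautForm_apply (contDiffAt_metricForm g he hz)]
  simp only [map_add]
  rw [metricForm_symm g e _ (tangentCoordDeriv e p u).1 (christoffelVec _ _ _ _ _),
    metricForm_symm g e _ (tangentCoordDeriv e p v).1 (christoffelVec _ _ _ _ _),
    metricForm_christoffelVec g he hz, metricForm_christoffelVec g he hz,
    metricForm_symm g e _ (tangentCoordDeriv e p u).1 (tangentCoordDeriv e p v).2,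
    metricForm_symm g e _ (tangentCoordDeriv e p v).1 (tangentCoordDeriv e p u).2,
    fderiv_metricForm_symm g he hz (tangentCoordDeriv e p u).1 (tangentCoordDeriv e p v).1,
    fderiv_metricForm_symm g he hz (tangentCoordDeriv e p v).1 (tangentCoordDeriv e p u).1,
    fderiv_metricForm_symm g he hz _ (tangentCoordDeriv e p v).1 (tangentCoordDeriv e p u).1]
  ring

end LocalForms

/-! ### Independence of the chart. -/

section ChartIndependence

variable {n r s : ℕ} {M : Type*} [TopologicalSpace M]
  [ChartedSpace (EuclideanSpace ℝ (Fin n)) M] [IsManifold (𝓡 n) ∞ M]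
  (g : SemiRiemannianMetric n r s M)
  {e e' : OpenPartialHomeomorph M (EuclideanSpace ℝ (Fin n))}

theorem metricForm_mfderiv (he : e ∈ IsManifold.maximalAtlas (𝓡 n) ∞ M) {x : M}
    (hx : x ∈ e.source) (v w : TangentSpace (𝓡 n) x) :
    metricForm g e (e x) (mfderiv (𝓡 n) (𝓡 n) e x v) (mfderiv (𝓡 n) (𝓡 n) e x w) =
      g.val x v w := by
  have h := (mdifferentiable_of_mem he).symm_comp_deriv hx
  have h2 : ∀ (x' : M) (v' w' : EuclideanSpace ℝ (Fin n)), x' = x → v' = v → w' = w →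
      g.val x' v' w' = g.val x v w := by
    rintro x' v' w' rfl rfl rfl
    rfl
  exact (metricForm_eq g e _ _ _).trans (h2 _ _ _ (e.left_inv hx)
    (congrArg (fun L => L v) h) (congrArg (fun L => L w) h))

/-- Chain rule for `fst ∘ tangentCoord e = e ∘ π`. -/
theorem tangentCoordDeriv_fst (he : e ∈ IsManifold.maximalAtlas (𝓡 n) ∞ M)
    {p : TangentBundle (𝓡 n) M} (hp : p.proj ∈ e.source)
    (w : TangentSpace (𝓡 n).tangent p) :
    (tangentCoordDeriv e p w).1 = mfderiv (𝓡 n) (𝓡 n) e p.proj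
      (mfderiv (𝓡 n).tangent (𝓡 n) (fun q : TangentBundle (𝓡 n) M => q.proj) p w) := by
  have h := (mdifferentiableAt_tangentCoord he hp).hasMFDerivAt
  have hL := (ContinuousLinearMap.fst ℝ (EuclideanSpace ℝ (Fin n))
    (EuclideanSpace ℝ (Fin n))).hasMFDerivAt (x := tangentCoord e p)
  have h1 := (hL.comp p h).mfderiv
  have hπ : MDifferentiableAt (𝓡 n).tangent (𝓡 n)
      (fun q : TangentBundle (𝓡 n) M => q.proj) p :=
    (Bundle.contMDiff_proj (n := 1) (TangentSpace (𝓡 n))).mdifferentiableAt (by simp)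
  have h2 := ((mdifferentiable_of_mem he).mdifferentiableAt hp).hasMFDerivAt.comp p
    hπ.hasMFDerivAt
  exact congrArg (fun L => L w) (h1.symm.trans h2.mfderiv)

/-- The right side involves no chart; this is the intrinsic description of `η₁`. -/
theorem tautForm_tangentCoord_apply (he : e ∈ IsManifold.maximalAtlas (𝓡 n) ∞ M)
    {p : TangentBundle (𝓡 n) M} (hp : p.proj ∈ e.source)
    (w : TangentSpace (𝓡 n).tangent p) :
    metricForm g e (tangentCoord e p).1 (tangentCoord e p).2 (tangentCoordDeriv e p w).1 =
      g.val p.proj p.snd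
        (mfderiv (𝓡 n).tangent (𝓡 n) (fun q : TangentBundle (𝓡 n) M => q.proj) p w) := by
  rw [tangentCoordDeriv_fst he hp]
  exact metricForm_mfderiv g he hp _ _

theorem eta1In_eq_eta1In (he : e ∈ IsManifold.maximalAtlas (𝓡 n) ∞ M)
    (he' : e' ∈ IsManifold.maximalAtlas (𝓡 n) ∞ M)
    {p : TangentBundle (𝓡 n) M} (hp : p.proj ∈ e.source) (hp' : p.proj ∈ e'.source) :
    eta1In g e p = eta1In g e' p := by
  rw [eta1In_eq g he hp, eta1In_eq g he' hp']
  ext w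
  exact (tautForm_tangentCoord_apply g he hp (w 0)).trans
    (tautForm_tangentCoord_apply g he' hp' (w 0)).symm

theorem contDiffAt_tangentCoord_transition (he : e ∈ IsManifold.maximalAtlas (𝓡 n) ∞ M)
    (he' : e' ∈ IsManifold.maximalAtlas (𝓡 n) ∞ M)
    {p : TangentBundle (𝓡 n) M} (hp : p.proj ∈ e.source) (hp' : p.proj ∈ e'.source) :
    ContDiffAt ℝ ∞ (tangentCoord e' ∘ tangentCoordSymm e) (tangentCoord e p) := by
  rw [← contMDiffAt_iff_contDiffAt]
  have hl : tangentCoordSymm e (tangentCoord e p) = p := (tangentChart he).left_inv hp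
  have h1 := (contMDiffOn_tangentCoordSymm he).contMDiffAt
    ((tangentChart he).open_target.mem_nhds ((tangentChart he).map_source hp))
  refine ContMDiffAt.comp (tangentCoord e p) ?_ h1
  exact hl.symm ▸ (contMDiffOn_tangentCoord he').contMDiffAt
    ((tangentChart he').open_source.mem_nhds hp')

theorem tangentCoordDeriv_eq_comp (he : e ∈ IsManifold.maximalAtlas (𝓡 n) ∞ M)
    (he' : e' ∈ IsManifold.maximalAtlas (𝓡 n) ∞ M)
    {p : TangentBundle (𝓡 n) M} (hp : p.proj ∈ e.source) (hp' : p.proj ∈ e'.source) :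
    tangentCoordDeriv e' p =
      (fderiv ℝ (tangentCoord e' ∘ tangentCoordSymm e) (tangentCoord e p)).comp
        (tangentCoordDeriv e p) := by
  have h := (mdifferentiableAt_tangentCoord he hp).hasMFDerivAt
  have hF := ((contDiffAt_tangentCoord_transition he he' hp hp').differentiableAt
    (by simp)).hasFDerivAt.hasMFDerivAt
  have h1 := hF.comp p h
  have h2 : tangentCoord e' =ᶠ[𝓝 p] (tangentCoord e' ∘ tangentCoordSymm e) ∘ tangentCoord e := by
    filter_upwards [(tangentChart he).open_source.mem_nhds hp] with q hq
    exact congrArg (tangentCoord e') ((tangentChart he).left_inv hq).symm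
  exact h2.mfderiv_eq.trans h1.mfderiv

theorem tangentCoordDeriv_surjective (he : e ∈ IsManifold.maximalAtlas (𝓡 n) ∞ M)
    {p : TangentBundle (𝓡 n) M} (hp : p.proj ∈ e.source) :
    Function.Surjective (tangentCoordDeriv e p) :=
  (mdifferentiable_tangentChart he).mfderiv_surjective (x := p) hp

theorem tangentCoordDeriv_injective (he : e ∈ IsManifold.maximalAtlas (𝓡 n) ∞ M)
    {p : TangentBundle (𝓡 n) M} (hp : p.proj ∈ e.source) :
    Function.Injective (tangentCoordDeriv e p) :=
  (mdifferentiable_tangentChart he).mfderiv_injective (x := p) hp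

/-- Invariance of `η₁`, rewritten on the coordinate side as a pullback by the transition map. It
must hold on a neighbourhood, because it is going to be differentiated. -/
theorem tautForm_eventuallyEq (he : e ∈ IsManifold.maximalAtlas (𝓡 n) ∞ M)
    (he' : e' ∈ IsManifold.maximalAtlas (𝓡 n) ∞ M)
    {p : TangentBundle (𝓡 n) M} (hp : p.proj ∈ e.source) (hp' : p.proj ∈ e'.source) :
    tautForm (metricForm g e) =ᶠ[𝓝 (tangentCoord e p)] fun z =>
      (tautForm (metricForm g e') ((tangentCoord e' ∘ tangentCoordSymm e) z))
        |>.compContinuousLinearMap (fderiv ℝ (tangentCoord e' ∘ tangentCoordSymm e) z) := by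
  have ho := ((tangentChart he).isOpen_inter_preimage_symm (tangentChart he').open_source)
  filter_upwards [ho.mem_nhds ⟨(tangentChart he).map_source hp, by
    change (tangentChart he).symm (tangentChart he p) ∈ (tangentChart he').source
    rw [(tangentChart he).left_inv hp]
    exact hp'⟩] with z hz
  obtain ⟨hz, hz' : (tangentCoordSymm e z).proj ∈ e'.source⟩ := hz
  have hr : tangentCoord e (tangentCoordSymm e z) = z := (tangentChart he).right_inv hz
  have hq : (tangentCoordSymm e z).proj ∈ e.source := (tangentChart he).map_target hz
  have h := eta1In_eq_eta1In g he he' hq hz'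
  rw [eta1In_eq g he hq, eta1In_eq g he' hz', tangentCoordDeriv_eq_comp he he' hq hz', hr] at h
  ext w
  -- Surjectivity cancels the common factor `tangentCoordDeriv e`.
  obtain ⟨u, hu⟩ := tangentCoordDeriv_surjective he hq (w 0)
  have h1 := congrArg (fun L => L fun _ => u) h
  have hw : w = fun _ => tangentCoordDeriv e (tangentCoordSymm e z) u := by
    funext i
    rw [Subsingleton.elim i 0, hu]
  rw [hw]
  exact h1

/-- Over `ℝ`, twice continuous differentiability suffices for the symmetry of second derivatives, on
which naturality of `d` and `d ∘ d = 0` depend. -/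
theorem minSmoothness_two_le : minSmoothness ℝ 2 ≤ (∞ : WithTop ℕ∞) := by
  rw [minSmoothness_of_isRCLikeNormedField]
  exact ENat.LEInfty.out

theorem Omega1In_eq_Omega1In (he : e ∈ IsManifold.maximalAtlas (𝓡 n) ∞ M)
    (he' : e' ∈ IsManifold.maximalAtlas (𝓡 n) ∞ M)
    {p : TangentBundle (𝓡 n) M} (hp : p.proj ∈ e.source) (hp' : p.proj ∈ e'.source) :
    Omega1In g e p = Omega1In g e' p := by
  have hl : (tangentCoord e' ∘ tangentCoordSymm e) (tangentCoord e p) = tangentCoord e' p :=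
    congrArg (tangentCoord e') ((tangentChart he).left_inv hp)
  have hd : DifferentiableAt ℝ (tautForm (metricForm g e'))
      ((tangentCoord e' ∘ tangentCoordSymm e) (tangentCoord e p)) := by
    rw [hl]
    exact (contDiffAt_tautForm (contDiffAt_metricForm g he'
      (e'.map_source hp'))).differentiableAt (by simp)
  have h1 := extDeriv_pullback hd (contDiffAt_tangentCoord_transition he he' hp hp')
    minSmoothness_two_le
  have h2 : extDeriv (tautForm (metricForm g e)) (tangentCoord e p) = _ :=
    (tautForm_eventuallyEq g he he' hp hp').extDeriv_eq.trans h1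
  rw [Omega1In_eq g he hp, Omega1In_eq g he' hp', h2, hl, tangentCoordDeriv_eq_comp he he' hp hp']
  rfl

end ChartIndependence

/-! ### Smoothness, closedness and nondegeneracy on `TM`. -/

section GlobalForms

variable {n r s : ℕ} {M : Type*} [TopologicalSpace M]
  [ChartedSpace (EuclideanSpace ℝ (Fin n)) M] [IsManifold (𝓡 n) ∞ M]
  (g : SemiRiemannianMetric n r s M)

/-- Pulling `β` back by the chart and then by its inverse returns `β`. Together with `extDer_eq`
this moves questions about forms on `TM` to the model space. -/
theorem formInChart_eq {k : ℕ}
    {α : ∀ q : TangentBundle (𝓡 n) M, TangentSpace (𝓡 n).tangent q [⋀^Fin k]→L[ℝ] ℝ}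
    {p : TangentBundle (𝓡 n) M}
    {β : EuclideanSpace ℝ (Fin n) × EuclideanSpace ℝ (Fin n) →
      (EuclideanSpace ℝ (Fin n) × EuclideanSpace ℝ (Fin n)) [⋀^Fin k]→L[ℝ] ℝ}
    (hα : ∀ q : TangentBundle (𝓡 n) M,
      q.proj ∈ (chartAt (EuclideanSpace ℝ (Fin n)) p.proj).source →
      α q = (β (tangentCoord (chartAt _ p.proj) q)).compContinuousLinearMap
        (tangentCoordDeriv (chartAt _ p.proj) q)) :
    EqOn (formInChart (𝓡 n).tangent α p) β (extChartAt (𝓡 n).tangent p).target := by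
  intro z hz
  set e := chartAt (EuclideanSpace ℝ (Fin n)) p.proj with he0
  have he : e ∈ IsManifold.maximalAtlas (𝓡 n) ∞ M := mem_maximalAtlas_chartAt p.proj
  have hsymm := extChartAt_symm_eqOn p
  rw [extChartAt_target_eq] at hz
  have hz' : z ∈ (tangentChart he).target := hz
  -- Equality near `z`, not just at `z`, is needed to equate derivatives of the two inverse charts.
  have hev : (extChartAt (𝓡 n).tangent p).symm =ᶠ[𝓝 z] tangentCoordSymm e := by
    filter_upwards [(tangentChart he).open_target.mem_nhds hz'] with y hy
    refine hsymm ?_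
    rw [extChartAt_target_eq]
    exact hy
  have key : ∀ (q q' : TangentBundle (𝓡 n) M)
      (L L' : EuclideanSpace ℝ (Fin n) × EuclideanSpace ℝ (Fin n) →L[ℝ]
        EuclideanSpace ℝ (Fin n) × EuclideanSpace ℝ (Fin n)), q = q' → L = L' →
      (α q).compContinuousLinearMap L = (α q').compContinuousLinearMap L' := by
    rintro q q' L L' rfl rfl
    rfl
  have h1 : formInChart (𝓡 n).tangent α p z =
      (α (tangentCoordSymm e z)).compContinuousLinearMap
        (mfderiv 𝓘(ℝ, EuclideanSpace ℝ (Fin n) × EuclideanSpace ℝ (Fin n)) (𝓡 n).tangent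
          (tangentCoordSymm e) z) := by
    refine key _ _ _ _ hev.eq_of_nhds ?_
    rw [ModelWithCorners.range_eq_univ, mfderivWithin_univ]
    exact hev.mfderiv_eq
  have hr : tangentCoord e (tangentCoordSymm e z) = z := (tangentChart he).right_inv hz'
  have h2 := hα (tangentCoordSymm e z) ((tangentChart he).map_target hz')
  rw [hr] at h2
  have hc := (mdifferentiable_tangentChart he).comp_symm_deriv hz'
  rw [h1]
  ext w
  have h3 := congrArg (fun L => L fun i =>
    mfderiv 𝓘(ℝ, EuclideanSpace ℝ (Fin n) × EuclideanSpace ℝ (Fin n)) (𝓡 n).tangent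
      (tangentCoordSymm e) z (w i)) h2
  refine h3.trans (congrArg (β z) (funext fun i => ?_))
  exact congrArg (fun L => L (w i)) hc

theorem isSmoothForm_of_local {k : ℕ}
    {α : ∀ q : TangentBundle (𝓡 n) M, TangentSpace (𝓡 n).tangent q [⋀^Fin k]→L[ℝ] ℝ}
    {β : TangentBundle (𝓡 n) M → EuclideanSpace ℝ (Fin n) × EuclideanSpace ℝ (Fin n) →
      (EuclideanSpace ℝ (Fin n) × EuclideanSpace ℝ (Fin n)) [⋀^Fin k]→L[ℝ] ℝ}
    (hα : ∀ p q : TangentBundle (𝓡 n) M,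
      q.proj ∈ (chartAt (EuclideanSpace ℝ (Fin n)) p.proj).source →
      α q = (β p (tangentCoord (chartAt _ p.proj) q)).compContinuousLinearMap
        (tangentCoordDeriv (chartAt _ p.proj) q))
    (hβ : ∀ (p : TangentBundle (𝓡 n) M) (z),
      z.1 ∈ (chartAt (EuclideanSpace ℝ (Fin n)) p.proj).target → ContDiffAt ℝ ∞ (β p) z) :
    IsSmoothForm (𝓡 n).tangent α := by
  intro p
  refine ContDiffOn.congr (fun z hz => ?_) (formInChart_eq (hα p))
  rw [extChartAt_target_eq] at hz
  exact (hβ p z hz).contDiffWithinAt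

theorem extDer_eq {k : ℕ}
    {α : ∀ q : TangentBundle (𝓡 n) M, TangentSpace (𝓡 n).tangent q [⋀^Fin k]→L[ℝ] ℝ}
    {p : TangentBundle (𝓡 n) M}
    {β : EuclideanSpace ℝ (Fin n) × EuclideanSpace ℝ (Fin n) →
      (EuclideanSpace ℝ (Fin n) × EuclideanSpace ℝ (Fin n)) [⋀^Fin k]→L[ℝ] ℝ}
    (hα : ∀ q : TangentBundle (𝓡 n) M,
      q.proj ∈ (chartAt (EuclideanSpace ℝ (Fin n)) p.proj).source →
      α q = (β (tangentCoord (chartAt _ p.proj) q)).compContinuousLinearMap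
        (tangentCoordDeriv (chartAt _ p.proj) q)) :
    extDer (𝓡 n).tangent α p =
      (extDeriv β (tangentCoord (chartAt _ p.proj) p)).compContinuousLinearMap
        (tangentCoordDeriv (chartAt _ p.proj) p) := by
  have hp : p ∈ (extChartAt (𝓡 n).tangent p).source := mem_extChartAt_source p
  have hv : extChartAt (𝓡 n).tangent p p = tangentCoord (chartAt _ p.proj) p :=
    extChartAt_eqOn p hp
  have hd : mfderiv (𝓡 n).tangent
      𝓘(ℝ, EuclideanSpace ℝ (Fin n) × EuclideanSpace ℝ (Fin n))
      (extChartAt (𝓡 n).tangent p) p = tangentCoordDeriv (chartAt _ p.proj) p := by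
    refine Filter.EventuallyEq.mfderiv_eq ?_
    filter_upwards [(isOpen_extChartAt_source (I := (𝓡 n).tangent) p).mem_nhds hp] with q hq
    exact extChartAt_eqOn p hq
  have hx : extDeriv (formInChart (𝓡 n).tangent α p) (extChartAt (𝓡 n).tangent p p) =
      extDeriv β (tangentCoord (chartAt _ p.proj) p) := by
    rw [hv]
    refine Filter.EventuallyEq.extDeriv_eq ?_
    rw [← hv]
    filter_upwards [extChartAt_target_mem_nhds (I := (𝓡 n).tangent) p] with z hz
    exact formInChart_eq hα hz
  unfold extDer
  rw [ModelWithCorners.range_eq_univ, extDerivWithin_univ, hx]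
  exact congrArg _ hd

omit [IsManifold (𝓡 n) ∞ M] in
theorem mem_chart_source_self (p : TangentBundle (𝓡 n) M) :
    p.proj ∈ (chartAt (EuclideanSpace ℝ (Fin n)) p.proj).source :=
  mem_chart_source _ _

theorem eta1_eq_eta1In {e : OpenPartialHomeomorph M (EuclideanSpace ℝ (Fin n))}
    (he : e ∈ IsManifold.maximalAtlas (𝓡 n) ∞ M) {p : TangentBundle (𝓡 n) M}
    (hp : p.proj ∈ e.source) : eta1 g p = eta1In g e p :=
  eta1In_eq_eta1In g (mem_maximalAtlas_chartAt _) he (mem_chart_source_self p) hp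

theorem Omega1_eq_Omega1In {e : OpenPartialHomeomorph M (EuclideanSpace ℝ (Fin n))}
    (he : e ∈ IsManifold.maximalAtlas (𝓡 n) ∞ M) {p : TangentBundle (𝓡 n) M}
    (hp : p.proj ∈ e.source) : Omega1 g p = Omega1In g e p :=
  Omega1In_eq_Omega1In g (mem_maximalAtlas_chartAt _) he (mem_chart_source_self p) hp

theorem eta1_local (p q : TangentBundle (𝓡 n) M)
    (hq : q.proj ∈ (chartAt (EuclideanSpace ℝ (Fin n)) p.proj).source) :
    eta1 g q = (tautForm (metricForm g (chartAt _ p.proj))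
      (tangentCoord (chartAt _ p.proj) q)).compContinuousLinearMap
        (tangentCoordDeriv (chartAt _ p.proj) q) :=
  (eta1_eq_eta1In g (mem_maximalAtlas_chartAt _) hq).trans
    (eta1In_eq g (mem_maximalAtlas_chartAt _) hq)

theorem Omega1_local (p q : TangentBundle (𝓡 n) M)
    (hq : q.proj ∈ (chartAt (EuclideanSpace ℝ (Fin n)) p.proj).source) :
    Omega1 g q = ((-extDeriv (tautForm (metricForm g (chartAt _ p.proj))))
      (tangentCoord (chartAt _ p.proj) q)).compContinuousLinearMap
        (tangentCoordDeriv (chartAt _ p.proj) q) :=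
  (Omega1_eq_Omega1In g (mem_maximalAtlas_chartAt _) hq).trans
    (Omega1In_eq g (mem_maximalAtlas_chartAt _) hq)

theorem isSmoothForm_eta1 : IsSmoothForm (𝓡 n).tangent (eta1 g) :=
  isSmoothForm_of_local (eta1_local g) fun _ _ hz =>
    contDiffAt_tautForm (contDiffAt_metricForm g (mem_maximalAtlas_chartAt _) hz)

theorem isSmoothForm_Omega1 : IsSmoothForm (𝓡 n).tangent (Omega1 g) :=
  isSmoothForm_of_local (Omega1_local g) fun _ _ hz =>
    (contDiffAt_extDeriv (contDiffAt_tautForm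
      (contDiffAt_metricForm g (mem_maximalAtlas_chartAt _) hz))).neg

theorem Omega1_eq_neg_extDer (p : TangentBundle (𝓡 n) M) :
    Omega1 g p = -extDer (𝓡 n).tangent (eta1 g) p := by
  rw [extDer_eq (eta1_local g p), Omega1_local g p p (mem_chart_source_self p)]
  rfl

theorem extDer_Omega1 (p : TangentBundle (𝓡 n) M) : extDer (𝓡 n).tangent (Omega1 g) p = 0 := by
  have hz := (chartAt (EuclideanSpace ℝ (Fin n)) p.proj).map_source (mem_chart_source_self p)
  have h0 : extDeriv (-extDeriv (tautForm (metricForm g (chartAt _ p.proj))))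
      (tangentCoord (chartAt _ p.proj) p) = 0 := by
    have h1 := extDeriv_smul (-1 : ℝ) (extDeriv (tautForm (metricForm g (chartAt _ p.proj))))
      (x := tangentCoord (chartAt _ p.proj) p)
    rw [extDeriv_extDeriv_apply (contDiffAt_tautForm (contDiffAt_metricForm g
      (mem_maximalAtlas_chartAt p.proj) hz)) minSmoothness_two_le, smul_zero,
      neg_one_smul] at h1
    exact h1
  rw [extDer_eq (Omega1_local g p), h0]
  rfl

/-- In the chart `e`, the form `Ω₁` is `g(dx, δy') - g(dx', δy)`. -/
theorem Omega1_apply {e : OpenPartialHomeomorph M (EuclideanSpace ℝ (Fin n))}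
    (he : e ∈ IsManifold.maximalAtlas (𝓡 n) ∞ M) {p : TangentBundle (𝓡 n) M}
    (hp : p.proj ∈ e.source) (u v : TangentSpace (𝓡 n).tangent p) :
    Omega1 g p ![u, v] =
      metricForm g e (tangentCoord e p).1 (tangentCoordDeriv e p u).1
          ((tangentCoordDeriv e p v).2 + christoffelVec g e (tangentCoord e p).1
            (tangentCoordDeriv e p v).1 (tangentCoord e p).2) -
        metricForm g e (tangentCoord e p).1 (tangentCoordDeriv e p v).1
          ((tangentCoordDeriv e p u).2 + christoffelVec g e (tangentCoord e p).1
            (tangentCoordDeriv e p u).1 (tangentCoord e p).2) := by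
  rw [Omega1_eq_Omega1In g he hp, Omega1In_apply g he hp]

theorem Omega1_nondegenerate (p : TangentBundle (𝓡 n) M) (u : TangentSpace (𝓡 n).tangent p)
    (hu : ∀ v : TangentSpace (𝓡 n).tangent p, Omega1 g p ![u, v] = 0) : u = 0 := by
  set e := chartAt (EuclideanSpace ℝ (Fin n)) p.proj with he0
  have he : e ∈ IsManifold.maximalAtlas (𝓡 n) ∞ M := mem_maximalAtlas_chartAt p.proj
  have hp : p.proj ∈ e.source := mem_chart_source_self p
  have hz : (tangentCoord e p).1 ∈ e.target := e.map_source hp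
  have h : ∀ a b : EuclideanSpace ℝ (Fin n), metricForm g e (tangentCoord e p).1
      (tangentCoordDeriv e p u).1 (b + christoffelVec g e (tangentCoord e p).1 a
        (tangentCoord e p).2) - metricForm g e (tangentCoord e p).1 a
          ((tangentCoordDeriv e p u).2 + christoffelVec g e (tangentCoord e p).1
            (tangentCoordDeriv e p u).1 (tangentCoord e p).2) = 0 := by
    intro a b
    obtain ⟨v, hv⟩ := tangentCoordDeriv_surjective he hp (a, b)
    have := hu v
    rwa [Omega1_apply g he hp, hv] at this
  have h1 : (tangentCoordDeriv e p u).1 = 0 := by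
    refine metricForm_nondegenerate g he hz _ fun b => ?_
    -- With `a = 0` the second term vanishes, and the shift of `b` makes the argument of the first
    -- exactly `b`.
    have := h 0 (b - christoffelVec g e (tangentCoord e p).1 0 (tangentCoord e p).2)
    simpa using this
  have h2 : (tangentCoordDeriv e p u).2 = 0 := by
    refine metricForm_nondegenerate g he hz _ fun a => ?_
    -- As the first component of `u` is now zero, only `-g(a, u₂ + Γ(0,y))` remains, and `Γ(0,y) =
    -- 0`.
    have h3 := h a 0
    have h4 : christoffelVec g e (tangentCoord e p).1 0 (tangentCoord e p).2 = 0 := by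
      ext k
      simp [christoffelVec]
    rw [h1, h4] at h3
    rw [metricForm_symm]
    simpa using h3
  refine tangentCoordDeriv_injective he hp ?_
  rw [map_zero]
  exact Prod.ext h1 h2

theorem isSymplectic_Omega1 : IsSymplectic (𝓡 n).tangent (Omega1 g) :=
  ⟨isSmoothForm_Omega1 g, extDer_Omega1 g, Omega1_nondegenerate g⟩

end GlobalForms

set_option maxSynthPendingDepth 3

/-! ### The Hamilton field: existence, uniqueness and smoothness. -/

section Hamilton

variable {n r s : ℕ} {M : Type*} [TopologicalSpace M]
  [ChartedSpace (EuclideanSpace ℝ (Fin n)) M] [IsManifold (𝓡 n) ∞ M]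
  (g : SemiRiemannianMetric n r s M)

theorem contMDiff_energy {X : ∀ x : M, TangentSpace (𝓡 n) x}
    (hX : ContMDiff (𝓡 n) (𝓡 n).tangent ∞
      (fun x => (⟨x, X x⟩ : TangentBundle (𝓡 n) M))) :
    ContMDiff (𝓡 n) 𝓘(ℝ, ℝ) ∞ (energy g X) := by
  have hb : ContMDiff (𝓡 n) ((𝓡 n).prod 𝓘(ℝ)) ∞
      (fun x => Bundle.TotalSpace.mk' ℝ (E := Bundle.Trivial M ℝ) x (g.val x (X x) (X x))) :=
    ContMDiff.clm_bundle_apply₂ (F₁ := EuclideanSpace ℝ (Fin n))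
      (F₂ := EuclideanSpace ℝ (Fin n)) g.contMDiff hX hX
  intro x
  have h := hb x
  simp only [Bundle.contMDiffAt_totalSpace] at h
  exact contMDiffAt_const.mul h.2

theorem contMDiff_hamiltonian {f : M → ℝ} (hf : ContMDiff (𝓡 n) 𝓘(ℝ, ℝ) ∞ f) :
    ContMDiff (𝓡 n).tangent 𝓘(ℝ, ℝ) ∞ (hamiltonian g f) := by
  have hπ : ContMDiff (𝓡 n).tangent (𝓡 n) ∞ (fun p : TangentBundle (𝓡 n) M => p.proj) :=
    Bundle.contMDiff_proj (TangentSpace (𝓡 n))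
  have hid : ContMDiff (𝓡 n).tangent (𝓡 n).tangent ∞
      (fun p : TangentBundle (𝓡 n) M => (⟨p.proj, p.snd⟩ : TangentBundle (𝓡 n) M)) :=
    contMDiff_id
  have hb : ContMDiff (𝓡 n).tangent ((𝓡 n).prod 𝓘(ℝ)) ∞
      (fun p : TangentBundle (𝓡 n) M => Bundle.TotalSpace.mk' ℝ (E := Bundle.Trivial M ℝ)
        p.proj (g.val p.proj p.snd p.snd)) :=
    ContMDiff.clm_bundle_apply₂ (F₁ := EuclideanSpace ℝ (Fin n))
      (F₂ := EuclideanSpace ℝ (Fin n)) (g.contMDiff.comp hπ) hid hid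
  intro x
  have h := hb x
  simp only [Bundle.contMDiffAt_totalSpace] at h
  exact (contMDiffAt_const.mul h.2).sub (hf.comp hπ).contMDiffAt

theorem isInvertible_val (x : M) : (g.val x).IsInvertible :=
  isInvertible_of_nondegenerate (E := EuclideanSpace ℝ (Fin n)) (B := g.val x)
    (g.nondegenerate x)

theorem val_grad (f : M → ℝ) (x : M) (w : TangentSpace (𝓡 n) x) :
    g.val x (grad g f x) w = mfderiv (𝓡 n) 𝓘(ℝ, ℝ) f x w :=
  congrArg (fun L => L w) ((isInvertible_val g x).self_apply_inverse _)

variable {e : OpenPartialHomeomorph M (EuclideanSpace ℝ (Fin n))}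
  (f : M → ℝ)

variable (e) in
/-- The components of `grad f` in the chart `e`. -/
def gradVec (z : EuclideanSpace ℝ (Fin n)) : EuclideanSpace ℝ (Fin n) :=
  (metricForm g e z).inverse (fderiv ℝ (f ∘ e.symm) z)

variable (e) in
/-- The Hamilton field in the coordinates `(x, y)`. -/
def hamiltonVec (z : EuclideanSpace ℝ (Fin n) × EuclideanSpace ℝ (Fin n)) :
    EuclideanSpace ℝ (Fin n) × EuclideanSpace ℝ (Fin n) :=
  (z.2, gradVec g e f z.1 - christoffelVec g e z.1 z.2 z.2)

variable {f}

omit [IsManifold (𝓡 n) ∞ M] in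
theorem contDiffAt_comp_chart_symm (he : e ∈ IsManifold.maximalAtlas (𝓡 n) ∞ M)
    (hf : ContMDiff (𝓡 n) 𝓘(ℝ, ℝ) ∞ f) {z : EuclideanSpace ℝ (Fin n)} (hz : z ∈ e.target) :
    ContDiffAt ℝ ∞ (f ∘ e.symm) z :=
  contMDiffAt_iff_contDiffAt.1 (hf.contMDiffAt.comp z
    ((contMDiffOn_symm_of_mem_maximalAtlas he).contMDiffAt (e.open_target.mem_nhds hz)))

theorem contDiffAt_inverse_metricForm (he : e ∈ IsManifold.maximalAtlas (𝓡 n) ∞ M)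
    {E : Type*} [NormedAddCommGroup E] [NormedSpace ℝ E] {φ : E → EuclideanSpace ℝ (Fin n)}
    {α : E → EuclideanSpace ℝ (Fin n) →L[ℝ] ℝ} {z : E}
    (hφ : ContDiffAt ℝ ∞ φ z) (hα : ContDiffAt ℝ ∞ α z) (hz : φ z ∈ e.target) :
    ContDiffAt ℝ ∞ (fun z => (metricForm g e (φ z)).inverse (α z)) z := by
  have h1 : ContDiffAt ℝ ∞ (fun z => metricForm g e (φ z)) z :=
    (contDiffAt_metricForm g he hz).comp z hφ
  have h2 : ContDiffAt ℝ ∞ (fun z => (metricForm g e (φ z)).inverse) z :=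
    ContDiffAt.comp (g := ContinuousLinearMap.inverse) z
      ((isInvertible_metricForm g he hz).contDiffAt_map_inverse) h1
  exact h2.clm_apply hα

theorem metricForm_gradVec (he : e ∈ IsManifold.maximalAtlas (𝓡 n) ∞ M)
    {z : EuclideanSpace ℝ (Fin n)} (hz : z ∈ e.target) (w : EuclideanSpace ℝ (Fin n)) :
    metricForm g e z (gradVec g e f z) w = fderiv ℝ (f ∘ e.symm) z w :=
  congrArg (fun L => L w) ((isInvertible_metricForm g he hz).self_apply_inverse _)

/-- Both vectors represent `df` through the metric in the chart, which is injective as a map to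
covectors. -/
theorem mfderiv_grad (he : e ∈ IsManifold.maximalAtlas (𝓡 n) ∞ M)
    (hf : ContMDiff (𝓡 n) 𝓘(ℝ, ℝ) ∞ f) {x : M} (hx : x ∈ e.source) :
    mfderiv (𝓡 n) (𝓡 n) e x (grad g f x) = gradVec g e f (e x) := by
  have hz := e.map_source hx
  refine (isInvertible_metricForm g he hz).injective ?_
  ext w
  obtain ⟨v, rfl⟩ := (mdifferentiable_of_mem he).mfderiv_surjective hx w
  have h1 := (contDiffAt_comp_chart_symm he hf hz).differentiableAt (by simp)
  have h2 := h1.hasFDerivAt.hasMFDerivAt.comp x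
    ((mdifferentiable_of_mem he).mdifferentiableAt hx).hasMFDerivAt
  have h3 : f =ᶠ[𝓝 x] (f ∘ e.symm) ∘ e := by
    filter_upwards [e.open_source.mem_nhds hx] with q hq
    simp [e.left_inv hq]
  have h4 := congrArg (fun L => L v) (h3.mfderiv_eq.trans h2.mfderiv)
  exact (metricForm_mfderiv g he hx _ _).trans ((val_grad g f x v).trans
    (h4.trans (metricForm_gradVec g he hz _).symm))

theorem contDiffAt_hamiltonVec (he : e ∈ IsManifold.maximalAtlas (𝓡 n) ∞ M)
    (hf : ContMDiff (𝓡 n) 𝓘(ℝ, ℝ) ∞ f)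
    {z : EuclideanSpace ℝ (Fin n) × EuclideanSpace ℝ (Fin n)} (hz : z.1 ∈ e.target) :
    ContDiffAt ℝ ∞ (hamiltonVec g e f) z := by
  have hA : ContDiffAt ℝ ∞ (fun z : EuclideanSpace ℝ (Fin n) × EuclideanSpace ℝ (Fin n) =>
      fderiv ℝ (f ∘ e.symm) z.1) z :=
    ((contDiffAt_comp_chart_symm he hf hz).fderiv_right (m := ∞) (by simp)).comp z contDiffAt_fst
  have hG : ContDiffAt ℝ ∞ (fun z : EuclideanSpace ℝ (Fin n) × EuclideanSpace ℝ (Fin n) =>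
      fderiv ℝ (metricForm g e) z.1) z :=
    ((contDiffAt_metricForm g he hz).fderiv_right (m := ∞) (by simp)).comp z contDiffAt_fst
  have hG1 : ContDiffAt ℝ ∞ (fun z : EuclideanSpace ℝ (Fin n) × EuclideanSpace ℝ (Fin n) =>
      fderiv ℝ (metricForm g e) z.1 z.2 z.2) z :=
    (hG.clm_apply contDiffAt_snd).clm_apply contDiffAt_snd
  have hG2 : ContDiffAt ℝ ∞ (fun z : EuclideanSpace ℝ (Fin n) × EuclideanSpace ℝ (Fin n) =>
      ((fderiv ℝ (metricForm g e) z.1).flip z.2).flip z.2) z := by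
    have hflip : ∀ {F : Type _} [NormedAddCommGroup F] [NormedSpace ℝ F]
        {B : EuclideanSpace ℝ (Fin n) × EuclideanSpace ℝ (Fin n) →
          EuclideanSpace ℝ (Fin n) →L[ℝ] EuclideanSpace ℝ (Fin n) →L[ℝ] F},
        ContDiffAt ℝ ∞ B z → ContDiffAt ℝ ∞ (fun z => (B z).flip z.2) z := fun {F} _ _ B hB =>
      ((ContinuousLinearMap.flipₗᵢ ℝ (EuclideanSpace ℝ (Fin n)) (EuclideanSpace ℝ (Fin n))
        F).contDiff.contDiffAt.comp z hB).clm_apply contDiffAt_snd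
    exact hflip (hflip hG)
  have hΓ : ContDiffAt ℝ ∞ (fun z : EuclideanSpace ℝ (Fin n) × EuclideanSpace ℝ (Fin n) =>
      (metricForm g e z.1).inverse ((1 / 2 : ℝ) • (fderiv ℝ (metricForm g e) z.1 z.2 z.2 +
        fderiv ℝ (metricForm g e) z.1 z.2 z.2 -
        ((fderiv ℝ (metricForm g e) z.1).flip z.2).flip z.2))) z :=
    contDiffAt_inverse_metricForm g he contDiffAt_fst
      (((hG1.add hG1).sub hG2).const_smul (1 / 2 : ℝ)) hz
  refine contDiffAt_snd.prodMk (ContDiffAt.sub ?_ (hΓ.congr_of_eventuallyEq ?_))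
  · exact contDiffAt_inverse_metricForm g he contDiffAt_fst hA hz
  · filter_upwards [(e.open_target.preimage continuous_fst).mem_nhds hz] with y hy
    exact christoffelVec_eq g he hy _ _

theorem hamiltonian_eq (he : e ∈ IsManifold.maximalAtlas (𝓡 n) ∞ M)
    {p : TangentBundle (𝓡 n) M} (hp : p.proj ∈ e.source) :
    hamiltonian g f p = (1 / 2) * metricForm g e (tangentCoord e p).1 (tangentCoord e p).2
      (tangentCoord e p).2 - (f ∘ e.symm) (tangentCoord e p).1 := by
  have h := metricForm_mfderiv g he hp p.snd p.snd
  have h2 : (f ∘ e.symm) (tangentCoord e p).1 = f p.proj := congrArg f (e.left_inv hp)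
  rw [h2, hamiltonian, ← h]
  rfl

theorem mfderiv_hamiltonian (he : e ∈ IsManifold.maximalAtlas (𝓡 n) ∞ M)
    (hf : ContMDiff (𝓡 n) 𝓘(ℝ, ℝ) ∞ f) {p : TangentBundle (𝓡 n) M} (hp : p.proj ∈ e.source)
    (w : TangentSpace (𝓡 n).tangent p) :
    @Eq ℝ (mfderiv (𝓡 n).tangent 𝓘(ℝ, ℝ) (hamiltonian g f) p w)
      ((1 / 2) * fderiv ℝ (metricForm g e) (tangentCoord e p).1 (tangentCoordDeriv e p w).1
        (tangentCoord e p).2 (tangentCoord e p).2 +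
      metricForm g e (tangentCoord e p).1 (tangentCoord e p).2 (tangentCoordDeriv e p w).2 -
      fderiv ℝ (f ∘ e.symm) (tangentCoord e p).1 (tangentCoordDeriv e p w).1) := by
  have hz : (tangentCoord e p).1 ∈ e.target := e.map_source hp
  set z := tangentCoord e p with hzdef
  have h0 : HasFDerivAt (metricForm g e) (fderiv ℝ (metricForm g e) z.1) z.1 :=
    ((contDiffAt_metricForm g he hz).differentiableAt (by simp)).hasFDerivAt
  have hfst : HasFDerivAt (fun z : EuclideanSpace ℝ (Fin n) × EuclideanSpace ℝ (Fin n) => z.1)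
      (ContinuousLinearMap.fst ℝ _ _) z := hasFDerivAt_fst
  have h1 := HasFDerivAt.comp
    (G := EuclideanSpace ℝ (Fin n) →L[ℝ] EuclideanSpace ℝ (Fin n) →L[ℝ] ℝ)
    (f := fun z : EuclideanSpace ℝ (Fin n) × EuclideanSpace ℝ (Fin n) => z.1) z h0 hfst
  have h2 := (h1.clm_apply hasFDerivAt_snd).clm_apply (hasFDerivAt_snd (𝕜 := ℝ) (p := z))
  have h3 := ((contDiffAt_comp_chart_symm he hf hz).differentiableAt (by simp)).hasFDerivAt.comp
    z hfst
  have h4 := ((h2.const_mul (1 / 2 : ℝ)).sub h3).hasMFDerivAt.comp p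
    (mdifferentiableAt_tangentCoord he hp).hasMFDerivAt
  have h5 : hamiltonian g f =ᶠ[𝓝 p]
      (fun z : EuclideanSpace ℝ (Fin n) × EuclideanSpace ℝ (Fin n) =>
        (1 / 2) * metricForm g e z.1 z.2 z.2 - (f ∘ e.symm) z.1) ∘ tangentCoord e := by
    filter_upwards [(tangentChart he).open_source.mem_nhds hp] with q hq
    exact hamiltonian_eq (f := f) g he hq
  have h6 := congrArg (fun L => L w) (h5.mfderiv_eq.trans h4.mfderiv)
  refine h6.trans ?_
  change (1 / 2 : ℝ) * (metricForm g e z.1 z.2 (tangentCoordDeriv e p w).2 +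
    (metricForm g e z.1 (tangentCoordDeriv e p w).2 z.2 +
      fderiv ℝ (metricForm g e) z.1 (tangentCoordDeriv e p w).1 z.2 z.2)) -
      fderiv ℝ (f ∘ e.symm) z.1 (tangentCoordDeriv e p w).1 = _
  rw [metricForm_symm g e z.1 (tangentCoordDeriv e p w).2 z.2]
  ring

/-- A vector with the coordinates of the Hamilton field is a Hamilton gradient. -/
theorem Omega1_apply_of_hamiltonVec (he : e ∈ IsManifold.maximalAtlas (𝓡 n) ∞ M)
    (hf : ContMDiff (𝓡 n) 𝓘(ℝ, ℝ) ∞ f) {p : TangentBundle (𝓡 n) M} (hp : p.proj ∈ e.source)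
    {u : TangentSpace (𝓡 n).tangent p}
    (hu : tangentCoordDeriv e p u = hamiltonVec g e f (tangentCoord e p))
    (w : TangentSpace (𝓡 n).tangent p) :
    Omega1 g p ![u, w] = mfderiv (𝓡 n).tangent 𝓘(ℝ, ℝ) (hamiltonian g f) p w := by
  have hz : (tangentCoord e p).1 ∈ e.target := e.map_source hp
  refine Eq.trans ?_ (mfderiv_hamiltonian g he hf hp w).symm
  rw [Omega1_apply g he hp, hu]
  -- The `δy` component of the Hamilton field is `grad f`: the `-Γ(y,y)` in its `y` component
  -- cancels the connection term.
  simp only [hamiltonVec, sub_add_cancel, map_add]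
  rw [metricForm_symm g e _ _ (christoffelVec _ _ _ _ _), metricForm_christoffelVec g he hz,
    metricForm_symm g e _ _ (gradVec _ _ _ _), metricForm_gradVec g he hz,
    fderiv_metricForm_symm g he hz (tangentCoord e p).2 (tangentCoordDeriv e p w).1]
  ring

theorem Omega1_injective (p : TangentBundle (𝓡 n) M) {u u' : TangentSpace (𝓡 n).tangent p}
    (h : ∀ v : TangentSpace (𝓡 n).tangent p, Omega1 g p ![u, v] = Omega1 g p ![u', v]) :
    u = u' := by
  rw [← sub_eq_zero]
  refine Omega1_nondegenerate g p _ fun v => ?_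
  have hupd : ∀ x y : TangentSpace (𝓡 n).tangent p, Function.update ![y, v] 0 x = ![x, v] := by
    intro x y
    ext i
    fin_cases i <;> rfl
  have h1 := (Omega1 g p).map_update_sub ![u, v] 0 u u'
  rw [hupd, hupd, hupd] at h1
  rw [h1, h v, sub_self]

variable (f) in
/-- The Hamilton field of `H(x, y) = (1/2) g(y, y) - f(x)` with respect to `Ω₁`. -/
def hamiltonField (p : TangentBundle (𝓡 n) M) : TangentSpace (𝓡 n).tangent p :=
  Function.surjInv
    (tangentCoordDeriv_surjective (mem_maximalAtlas_chartAt p.proj) (mem_chart_source_self p))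
    (hamiltonVec g (chartAt _ p.proj) f (tangentCoord (chartAt _ p.proj) p))

theorem isHamiltonGradient_hamiltonField (hf : ContMDiff (𝓡 n) 𝓘(ℝ, ℝ) ∞ f) :
    IsHamiltonGradient (𝓡 n).tangent (Omega1 g) (hamiltonian g f) (hamiltonField g f) :=
  fun p => Omega1_apply_of_hamiltonVec g (mem_maximalAtlas_chartAt p.proj) hf
    (mem_chart_source_self p) (Function.surjInv_eq _ _)

theorem isHamiltonGradient_iff (hf : ContMDiff (𝓡 n) 𝓘(ℝ, ℝ) ∞ f)
    (Z : ∀ p : TangentBundle (𝓡 n) M, TangentSpace (𝓡 n).tangent p) :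
    IsHamiltonGradient (𝓡 n).tangent (Omega1 g) (hamiltonian g f) Z ↔
      Z = hamiltonField g f := by
  refine ⟨fun h => funext fun p => Omega1_injective g p fun v => ?_, ?_⟩
  · rw [h p v, isHamiltonGradient_hamiltonField g hf p v]
  · rintro rfl
    exact isHamiltonGradient_hamiltonField g hf

/-- The field is built from preferred charts. In another chart, the vector with coordinates
`hamiltonVec` solves the same equation `Ω₁(u, ·) = dH`, so nondegeneracy identifies the two without
any transformation law for `Γ`. -/
theorem tangentCoordDeriv_hamiltonField (he : e ∈ IsManifold.maximalAtlas (𝓡 n) ∞ M)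
    (hf : ContMDiff (𝓡 n) 𝓘(ℝ, ℝ) ∞ f) {p : TangentBundle (𝓡 n) M} (hp : p.proj ∈ e.source) :
    tangentCoordDeriv e p (hamiltonField g f p) = hamiltonVec g e f (tangentCoord e p) := by
  obtain ⟨u, hu⟩ := tangentCoordDeriv_surjective he hp (hamiltonVec g e f (tangentCoord e p))
  rw [← hu]
  refine congrArg _ (Omega1_injective g p fun v => ?_)
  rw [isHamiltonGradient_hamiltonField g hf p v, Omega1_apply_of_hamiltonVec g he hf hp hu]

theorem contMDiff_hamiltonField (hf : ContMDiff (𝓡 n) 𝓘(ℝ, ℝ) ∞ f) :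
    ContMDiff (𝓡 n).tangent (𝓡 n).tangent.tangent ∞ (fun p => (⟨p, hamiltonField g f p⟩ :
      TangentBundle (𝓡 n).tangent (TangentBundle (𝓡 n) M))) := by
  intro p
  set e := chartAt (EuclideanSpace ℝ (Fin n)) p.proj with he0
  have he : e ∈ IsManifold.maximalAtlas (𝓡 n) ∞ M := mem_maximalAtlas_chartAt p.proj
  have hp : p ∈ (tangentChart he).source := mem_chart_source_self p
  have hT := (contMDiffOn_tangentCoordSymm he).contMDiffOn_tangentMapWithin (m := ∞) (by simp)
    (tangentChart he).open_target.uniqueMDiffOn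
  have hV : ContMDiffOn 𝓘(ℝ, EuclideanSpace ℝ (Fin n) × EuclideanSpace ℝ (Fin n))
      (𝓘(ℝ, EuclideanSpace ℝ (Fin n) × EuclideanSpace ℝ (Fin n))).tangent ∞
      (fun z => (⟨z, hamiltonVec g e f z⟩ :
        TangentBundle 𝓘(ℝ, EuclideanSpace ℝ (Fin n) × EuclideanSpace ℝ (Fin n))
          (EuclideanSpace ℝ (Fin n) × EuclideanSpace ℝ (Fin n)))) (tangentChart he).target :=
    contMDiffOn_vectorSpace_iff_contDiffOn.2 fun z hz =>
      (contDiffAt_hamiltonVec g he hf hz).contDiffWithinAt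
  have hc := (hT.comp hV fun z hz => hz).comp (contMDiffOn_tangentCoord he)
    fun q hq => (tangentChart he).map_source hq
  refine (hc.contMDiffAt ((tangentChart he).open_source.mem_nhds hp)).congr_of_eventuallyEq ?_
  filter_upwards [(tangentChart he).open_source.mem_nhds hp] with q hq
  have key : ∀ (q' : TangentBundle (𝓡 n) M)
      (w : EuclideanSpace ℝ (Fin n) × EuclideanSpace ℝ (Fin n)),
      q' = q → w = hamiltonField g f q → (⟨q, hamiltonField g f q⟩ :
        TangentBundle (𝓡 n).tangent (TangentBundle (𝓡 n) M)) = ⟨q', w⟩ := by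
    rintro q' w rfl rfl
    rfl
  refine key _ _ ((tangentChart he).left_inv hq) ?_
  have h1 := congrArg (fun L => L (hamiltonField g f q))
    ((mdifferentiable_tangentChart he).symm_comp_deriv hq)
  refine Eq.trans ?_ h1
  have h2 : mfderivWithin 𝓘(ℝ, EuclideanSpace ℝ (Fin n) × EuclideanSpace ℝ (Fin n))
      (𝓡 n).tangent (tangentCoordSymm e) (tangentChart he).target (tangentCoord e q) =
      mfderiv 𝓘(ℝ, EuclideanSpace ℝ (Fin n) × EuclideanSpace ℝ (Fin n))
      (𝓡 n).tangent (tangentCoordSymm e) (tangentCoord e q) :=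
    mfderivWithin_of_isOpen (tangentChart he).open_target ((tangentChart he).map_source hq)
  exact (congrArg (fun L => L (hamiltonVec g e f (tangentCoord e q))) h2).trans
    (congrArg (mfderiv 𝓘(ℝ, EuclideanSpace ℝ (Fin n) × EuclideanSpace ℝ (Fin n))
      (𝓡 n).tangent (tangentCoordSymm e) (tangentCoord e q))
      (tangentCoordDeriv_hamiltonField g he hf hq).symm)

end Hamilton

/-! ### Integral curves and trajectories. -/

section Components

variable {E F : Type*} [NormedAddCommGroup E] [NormedSpace ℝ E] [NormedAddCommGroup F]
  [NormedSpace ℝ F] {c : ℝ → E × F} {c' : E × F} {t : ℝ}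

theorem hasDerivAt_fst_of_prod (h : HasDerivAt c c' t) :
    HasDerivAt (fun τ => (c τ).1) c'.1 t := by
  simpa using h.hasFDerivAt.fst.hasDerivAt

theorem hasDerivAt_snd_of_prod (h : HasDerivAt c c' t) :
    HasDerivAt (fun τ => (c τ).2) c'.2 t := by
  simpa using h.hasFDerivAt.snd.hasDerivAt

end Components

section Curves

variable {n r s : ℕ} {M : Type*} [TopologicalSpace M]
  [ChartedSpace (EuclideanSpace ℝ (Fin n)) M] [IsManifold (𝓡 n) ∞ M]
  (g : SemiRiemannianMetric n r s M)
  {e : OpenPartialHomeomorph M (EuclideanSpace ℝ (Fin n))} {f : M → ℝ}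

theorem hasDerivAt_tangentCoord_comp (he : e ∈ IsManifold.maximalAtlas (𝓡 n) ∞ M)
    (hf : ContMDiff (𝓡 n) 𝓘(ℝ, ℝ) ∞ f) {γ : ℝ → TangentBundle (𝓡 n) M} {t : ℝ}
    (ht : (γ t).proj ∈ e.source)
    (hγ : HasMFDerivAt 𝓘(ℝ, ℝ) (𝓡 n).tangent γ t
      ((1 : ℝ →L[ℝ] ℝ).smulRight (hamiltonField g f (γ t)))) :
    HasDerivAt (fun τ => tangentCoord e (γ τ)) (hamiltonVec g e f (tangentCoord e (γ t))) t := by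
  have h1 := (mdifferentiableAt_tangentCoord he ht).hasMFDerivAt.comp t hγ
  let L : ℝ →L[ℝ] EuclideanSpace ℝ (Fin n) × EuclideanSpace ℝ (Fin n) :=
    (tangentCoordDeriv e (γ t)).comp ((1 : ℝ →L[ℝ] ℝ).smulRight (hamiltonField g f (γ t)))
  have h2 : HasFDerivAt (fun τ => tangentCoord e (γ τ)) L t := h1.hasFDerivAt
  have h3 : hamiltonVec g e f (tangentCoord e (γ t)) = L 1 := ?_
  · rw [h3]
    exact h2.hasDerivAt
  refine (tangentCoordDeriv_hamiltonField g he hf ht).symm.trans ?_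
  refine congrArg (tangentCoordDeriv e (γ t)) ?_
  exact (one_smul ℝ (hamiltonField g f (γ t))).symm

/-- Differentiability of the coordinates says nothing about `γ` outside the chart domain, so `ht`
must hold near `t`; then `γ` is locally `tangentCoordSymm e` applied to its coordinates. -/
theorem hasMFDerivAt_of_tangentCoord_comp (he : e ∈ IsManifold.maximalAtlas (𝓡 n) ∞ M)
    (hf : ContMDiff (𝓡 n) 𝓘(ℝ, ℝ) ∞ f) {γ : ℝ → TangentBundle (𝓡 n) M} {t : ℝ}
    (ht : ∀ᶠ τ in 𝓝 t, (γ τ).proj ∈ e.source)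
    (hγ : HasDerivAt (fun τ => tangentCoord e (γ τ))
      (hamiltonVec g e f (tangentCoord e (γ t))) t) :
    HasMFDerivAt 𝓘(ℝ, ℝ) (𝓡 n).tangent γ t
      ((1 : ℝ →L[ℝ] ℝ).smulRight (hamiltonField g f (γ t))) := by
  have hq : γ t ∈ (tangentChart he).source := ht.self_of_nhds
  have h0 : MDifferentiableAt 𝓘(ℝ, EuclideanSpace ℝ (Fin n) × EuclideanSpace ℝ (Fin n))
      (𝓡 n).tangent (tangentCoordSymm e) (tangentCoord e (γ t)) :=
    (mdifferentiable_tangentChart he).mdifferentiableAt_symm ((tangentChart he).map_source hq)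
  have h1 := h0.hasMFDerivAt.comp t hγ.hasFDerivAt.hasMFDerivAt
  have h2 : γ =ᶠ[𝓝 t] tangentCoordSymm e ∘ fun τ => tangentCoord e (γ τ) := by
    filter_upwards [ht] with τ hτ
    exact ((tangentChart he).left_inv hτ).symm
  have h3 := h1.congr_of_eventuallyEq h2
  have key : ∀ L L' : ℝ →L[ℝ] EuclideanSpace ℝ (Fin n) × EuclideanSpace ℝ (Fin n),
      L 1 = L' 1 → L = L' := fun L L' h => ContinuousLinearMap.ext_ring h
  refine h3.congr_mfderiv (key _ _ (Eq.symm ?_))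
  have h4 := congrArg (fun L => L (hamiltonField g f (γ t)))
    ((mdifferentiable_tangentChart he).symm_comp_deriv hq)
  have h5 := (congrArg (mfderiv 𝓘(ℝ, EuclideanSpace ℝ (Fin n) × EuclideanSpace ℝ (Fin n))
      (𝓡 n).tangent (tangentCoordSymm e) (tangentCoord e (γ t)))
      (tangentCoordDeriv_hamiltonField g he hf hq).symm).trans h4
  refine (one_smul ℝ (hamiltonField g f (γ t))).trans (h5.symm.trans ?_)
  refine congrArg (mfderiv 𝓘(ℝ, EuclideanSpace ℝ (Fin n) × EuclideanSpace ℝ (Fin n))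
      (𝓡 n).tangent (tangentCoordSymm e) (tangentCoord e (γ t))) ?_
  exact (one_smul ℝ (hamiltonVec g e f (tangentCoord e (γ t)))).symm

omit [IsManifold (𝓡 n) ∞ M] in
theorem hasDerivAt_chart_comp (he : e ∈ IsManifold.maximalAtlas (𝓡 n) ∞ M) {x : ℝ → M} {t : ℝ}
    (ht : x t ∈ e.source) (hx : MDifferentiableAt 𝓘(ℝ, ℝ) (𝓡 n) x t) :
    HasDerivAt (fun τ => e (x τ)) (mfderiv (𝓡 n) (𝓡 n) e (x t) (velocity x t)) t := by
  have h1 := ((mdifferentiable_of_mem he).mdifferentiableAt ht).hasMFDerivAt.comp t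
    hx.hasMFDerivAt
  let L : ℝ →L[ℝ] EuclideanSpace ℝ (Fin n) :=
    (mfderiv (𝓡 n) (𝓡 n) e (x t)).comp (mfderiv 𝓘(ℝ, ℝ) (𝓡 n) x t)
  have h2 : HasFDerivAt (fun τ => e (x τ)) L t := h1.hasFDerivAt
  exact h2.hasDerivAt

theorem mfderiv_covDerivAlong {x : ℝ → M} {V : ∀ t, TangentSpace (𝓡 n) (x t)} {t : ℝ}
    {y W' : EuclideanSpace ℝ (Fin n)}
    (hy : HasDerivAt (fun τ => chartAt (EuclideanSpace ℝ (Fin n)) (x t) (x τ)) y t)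
    (hW : HasDerivAt (fun τ => NormedSpace.fromTangentSpace (𝕜 := ℝ) _
      (mfderiv (𝓡 n) (𝓡 n) (chartAt (EuclideanSpace ℝ (Fin n)) (x t)) (x τ) (V τ))) W' t) :
    mfderiv (𝓡 n) (𝓡 n) (chartAt (EuclideanSpace ℝ (Fin n)) (x t)) (x t)
        (covDerivAlong g x V t) =
      W' + christoffelVec g (chartAt (EuclideanSpace ℝ (Fin n)) (x t)) (chartAt _ (x t) (x t)) y
        (NormedSpace.fromTangentSpace (𝕜 := ℝ) _
          (mfderiv (𝓡 n) (𝓡 n) (chartAt (EuclideanSpace ℝ (Fin n)) (x t)) (x t) (V t))) := by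
  have he : chartAt (EuclideanSpace ℝ (Fin n)) (x t) ∈ IsManifold.maximalAtlas (𝓡 n) ∞ M :=
    mem_maximalAtlas_chartAt _
  have hinv : (mfderiv (𝓡 n) (𝓡 n) (chartAt (EuclideanSpace ℝ (Fin n)) (x t))
      (x t)).IsInvertible :=
    ⟨(mdifferentiable_of_mem he).mfderiv (mem_chart_source _ (x t)), rfl⟩
  refine (hinv.self_apply_inverse _).trans ?_
  have hc : ∀ {c : ℝ → EuclideanSpace ℝ (Fin n)} {c' : EuclideanSpace ℝ (Fin n)},
      HasDerivAt c c' t → ∀ k, deriv (fun τ => c τ k) t = c' k := fun hc k =>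
    ((EuclideanSpace.proj k : EuclideanSpace ℝ (Fin n) →L[ℝ] ℝ).hasFDerivAt.comp_hasDerivAt
      t hc).deriv
  refine PiLp.ext (p := 2) (α := fun _ : Fin n => ℝ) fun k => ?_
  change deriv _ t + ∑ i : Fin n, ∑ j : Fin n, _ = W' k + ∑ i : Fin n, ∑ j : Fin n, _
  rw [hc hW k]
  refine congrArg _ (Finset.sum_congr rfl fun i _ => Finset.sum_congr rfl fun j _ => ?_)
  rw [hc hy i]

/-- This is the first Hamilton equation, `x' = y`. -/
theorem velocity_eq_snd (hf : ContMDiff (𝓡 n) 𝓘(ℝ, ℝ) ∞ f) {γ : ℝ → TangentBundle (𝓡 n) M}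
    {t : ℝ} (hγ : HasMFDerivAt 𝓘(ℝ, ℝ) (𝓡 n).tangent γ t
      ((1 : ℝ →L[ℝ] ℝ).smulRight (hamiltonField g f (γ t)))) :
    γ t = lift (fun τ => (γ τ).proj) t := by
  have he : chartAt (EuclideanSpace ℝ (Fin n)) (γ t).proj ∈
      IsManifold.maximalAtlas (𝓡 n) ∞ M := mem_maximalAtlas_chartAt (γ t).proj
  have ht := mem_chart_source_self (γ t)
  have h1 := hasDerivAt_tangentCoord_comp g he hf ht hγ
  have hπ : MDifferentiableAt (𝓡 n).tangent (𝓡 n)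
      (fun q : TangentBundle (𝓡 n) M => q.proj) (γ t) :=
    (Bundle.contMDiff_proj (n := 1) (TangentSpace (𝓡 n))).mdifferentiableAt (by simp)
  have h2 := hasDerivAt_chart_comp he (x := fun τ => (γ τ).proj) ht
    (hπ.comp t hγ.mdifferentiableAt)
  have h3 := hasDerivAt_fst_of_prod h1
  have h4 : velocity (fun τ => (γ τ).proj) t = (γ t).snd :=
    (mdifferentiable_of_mem he).mfderiv_injective ht (h2.unique h3)
  unfold lift
  rw [h4]

theorem isTrajectoryOn_of_hasMFDerivAt (hf : ContMDiff (𝓡 n) 𝓘(ℝ, ℝ) ∞ f)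
    {γ : ℝ → TangentBundle (𝓡 n) M} {J : Set ℝ} (hJ : IsOpen J)
    (hγ : ∀ t ∈ J, HasMFDerivAt 𝓘(ℝ, ℝ) (𝓡 n).tangent γ t
      ((1 : ℝ →L[ℝ] ℝ).smulRight (hamiltonField g f (γ t)))) :
    IsTrajectoryOn g f (fun τ => (γ τ).proj) J := by
  -- Around each time there is an open set of times on which the curve stays in one chart.
  have hloc : ∀ t ∈ J, ∃ U ∈ 𝓝 t, IsOpen U ∧ U ⊆ J ∧
      ∀ τ ∈ U, (γ τ).proj ∈ (chartAt (EuclideanSpace ℝ (Fin n)) (γ t).proj).source := by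
    intro t ht
    have h1 : ContinuousAt (fun τ => (γ τ).proj) t :=
      (FiberBundle.continuous_proj _ _).continuousAt.comp (hγ t ht).continuousAt
    have h2 := Filter.inter_mem (hJ.mem_nhds ht)
      (h1 ((chartAt (EuclideanSpace ℝ (Fin n)) (γ t).proj).open_source.mem_nhds
        (mem_chart_source_self (γ t))))
    obtain ⟨U, hU, hUo, hUt⟩ := mem_nhds_iff.1 h2
    exact ⟨U, hUo.mem_nhds hUt, hUo, fun τ hτ => (hU hτ).1, fun τ hτ => (hU hτ).2⟩
  constructor
  · intro t ht
    obtain ⟨U, hU, hUo, hUJ, hUs⟩ := hloc t ht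
    set e := chartAt (EuclideanSpace ℝ (Fin n)) (γ t).proj with he0
    have he : e ∈ IsManifold.maximalAtlas (𝓡 n) ∞ M := mem_maximalAtlas_chartAt _
    have hd : ∀ τ ∈ U, HasDerivAt (fun τ => tangentCoord e (γ τ))
        (hamiltonVec g e f (tangentCoord e (γ τ))) τ := fun τ hτ =>
      hasDerivAt_tangentCoord_comp g he hf (hUs τ hτ) (hγ τ (hUJ hτ))
    have hc0 : ContinuousOn (fun τ => tangentCoord e (γ τ)) U := fun τ hτ =>
      (hd τ hτ).continuousAt.continuousWithinAt
    -- Bootstrap: the coordinates are continuous, so their derivative `hamiltonVec` along the curve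
    -- is too and they are `C¹`. Then `x' = y` is `C¹` and `x` is `C²`.
    have hc1 : ContDiffOn ℝ 1 (fun τ => tangentCoord e (γ τ)) U := by
      rw [show (1 : WithTop ℕ∞) = 0 + 1 by simp, contDiffOn_succ_iff_deriv_of_isOpen hUo]
      refine ⟨fun τ hτ => (hd τ hτ).differentiableAt.differentiableWithinAt, by simp, ?_⟩
      rw [contDiffOn_zero]
      refine ContinuousOn.congr (f := fun τ => hamiltonVec g e f (tangentCoord e (γ τ))) ?_
        fun τ hτ => (hd τ hτ).deriv
      intro τ hτ
      exact ((contDiffAt_hamiltonVec g he hf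
        (e.map_source (hUs τ hτ))).continuousAt.comp_continuousWithinAt (hc0 τ hτ))
    have hc2 : ContDiffOn ℝ 2 (fun τ => (tangentCoord e (γ τ)).1) U := by
      rw [show (2 : WithTop ℕ∞) = 1 + 1 by norm_num, contDiffOn_succ_iff_deriv_of_isOpen hUo]
      have hd1 : ∀ τ ∈ U, HasDerivAt (fun τ => (tangentCoord e (γ τ)).1)
          (tangentCoord e (γ τ)).2 τ := fun τ hτ =>
        hasDerivAt_fst_of_prod (hd τ hτ)
      refine ⟨fun τ hτ => (hd1 τ hτ).differentiableAt.differentiableWithinAt, by simp, ?_⟩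
      exact (contDiff_snd.comp_contDiffOn hc1).congr fun τ hτ => (hd1 τ hτ).deriv
    have hx : ContMDiffAt 𝓘(ℝ, ℝ) (𝓡 n) 2 (e.symm ∘ fun τ => (tangentCoord e (γ τ)).1) t := by
      refine ContMDiffAt.comp t ?_ (hc2.contDiffAt hU).contMDiffAt
      exact ((contMDiffOn_symm_of_mem_maximalAtlas he).contMDiffAt (e.open_target.mem_nhds
        (e.map_source (mem_chart_source_self (γ t))))).of_le ENat.LEInfty.out
    refine (hx.congr_of_eventuallyEq ?_).contMDiffWithinAt
    filter_upwards [hU] with τ hτ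
    exact (e.left_inv (hUs τ hτ)).symm
  · intro t ht
    obtain ⟨U, hU, hUo, hUJ, hUs⟩ := hloc t ht
    have he : chartAt (EuclideanSpace ℝ (Fin n)) (γ t).proj ∈
      IsManifold.maximalAtlas (𝓡 n) ∞ M := mem_maximalAtlas_chartAt (γ t).proj
    have hs := mem_chart_source_self (γ t)
    have hd := hasDerivAt_tangentCoord_comp g he hf hs (hγ t ht)
    have hd1 := hasDerivAt_fst_of_prod hd
    have hd2 := hasDerivAt_snd_of_prod hd
    -- The covariant derivative differentiates the velocity, so it must agree with `y` on a
    -- neighbourhood of `t`.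
    have hev : (fun τ => NormedSpace.fromTangentSpace (𝕜 := ℝ) _
        (mfderiv (𝓡 n) (𝓡 n) (chartAt (EuclideanSpace ℝ (Fin n)) (γ t).proj) (γ τ).proj
          (velocity (fun τ => (γ τ).proj) τ))) =ᶠ[𝓝 t]
        fun τ => (tangentCoord (chartAt (EuclideanSpace ℝ (Fin n)) (γ t).proj) (γ τ)).2 := by
      filter_upwards [hU] with τ hτ
      exact congrArg (fun q : TangentBundle (𝓡 n) M =>
        (tangentCoord (chartAt (EuclideanSpace ℝ (Fin n)) (γ t).proj) q).2)
        (velocity_eq_snd g hf (hγ τ (hUJ hτ))).symm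
    have h1 := mfderiv_covDerivAlong g (x := fun τ => (γ τ).proj) hd1
      (hd2.congr_of_eventuallyEq hev)
    refine (mdifferentiable_of_mem he).mfderiv_injective hs (h1.trans ?_)
    rw [mfderiv_grad g he hf hs]
    have h2 := hev.self_of_nhds
    refine (congrArg (fun v => _ + christoffelVec g _ _ _ v) h2).trans ?_
    -- The second Hamilton equation: `(grad f - Γ(y,y)) + Γ(y,y) = grad f`.
    exact sub_add_cancel _ _

theorem hasMFDerivAt_of_isTrajectoryOn (hf : ContMDiff (𝓡 n) 𝓘(ℝ, ℝ) ∞ f)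
    {γ : ℝ → TangentBundle (𝓡 n) M} {J : Set ℝ} (hJ : IsOpen J)
    (hl : ∀ t ∈ J, γ t = lift (fun τ => (γ τ).proj) t)
    (hx : IsTrajectoryOn g f (fun τ => (γ τ).proj) J) {t : ℝ} (ht : t ∈ J) :
    HasMFDerivAt 𝓘(ℝ, ℝ) (𝓡 n).tangent γ t
      ((1 : ℝ →L[ℝ] ℝ).smulRight (hamiltonField g f (γ t))) := by
  obtain ⟨hx, hcov⟩ := hx
  set e := chartAt (EuclideanSpace ℝ (Fin n)) (γ t).proj with he0
  have he : e ∈ IsManifold.maximalAtlas (𝓡 n) ∞ M := mem_maximalAtlas_chartAt _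
  have hs : (γ t).proj ∈ e.source := mem_chart_source_self (γ t)
  have hxt := hx.contMDiffAt (hJ.mem_nhds ht)
  have hev : ∀ᶠ τ in 𝓝 t, (γ τ).proj ∈ e.source :=
    hxt.continuousAt (e.open_source.mem_nhds hs)
  have hex : ContDiffAt ℝ 2 (fun τ => e (γ τ).proj) t :=
    contMDiffAt_iff_contDiffAt.1 (ContMDiffAt.comp t
      (((contMDiffOn_of_mem_maximalAtlas he).contMDiffAt
        (e.open_source.mem_nhds hs)).of_le ENat.LEInfty.out) hxt)
  have hd : ∀ᶠ τ in 𝓝 t, HasDerivAt (fun τ => e (γ τ).proj) (tangentCoord e (γ τ)).2 τ := by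
    filter_upwards [hev, hJ.mem_nhds ht] with τ hτ hτJ
    have h1 := hasDerivAt_chart_comp he (x := fun τ => (γ τ).proj) hτ
      ((hx.contMDiffAt (hJ.mem_nhds hτJ)).mdifferentiableAt (by simp))
    refine h1.congr_deriv (Eq.symm ?_)
    exact congrArg (fun q : TangentBundle (𝓡 n) M => (tangentCoord e q).2) (hl τ hτJ)
  -- Near `t` the component `y` is the derivative of the `C²` curve `x`, hence differentiable at
  -- `t`.
  have hd2 : HasDerivAt (fun τ => (tangentCoord e (γ τ)).2)
      (deriv (deriv fun τ => e (γ τ).proj) t) t := by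
    have h1 : DifferentiableAt ℝ (deriv fun τ => e (γ τ).proj) t := by
      have h2 : ContDiffAt ℝ 1 (deriv fun τ => e (γ τ).proj) t :=
        ((ContinuousLinearMap.apply ℝ (EuclideanSpace ℝ (Fin n)) (1 : ℝ)).contDiff.contDiffAt.comp
          t (hex.fderiv_right (m := 1) (by norm_num)))
      exact h2.differentiableAt (by simp)
    refine h1.hasDerivAt.congr_of_eventuallyEq ?_
    filter_upwards [hd] with τ hτ
    exact hτ.deriv.symm
  have hW : (fun τ => NormedSpace.fromTangentSpace (𝕜 := ℝ) _
      (mfderiv (𝓡 n) (𝓡 n) e (γ τ).proj (velocity (fun τ => (γ τ).proj) τ))) =ᶠ[𝓝 t]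
      fun τ => (tangentCoord e (γ τ)).2 := by
    filter_upwards [hJ.mem_nhds ht] with τ hτ
    exact congrArg (fun q : TangentBundle (𝓡 n) M => (tangentCoord e q).2) (hl τ hτ).symm
  have h1 := mfderiv_covDerivAlong g (x := fun τ => (γ τ).proj) hd.self_of_nhds
    (hd2.congr_of_eventuallyEq hW)
  have h2 := (mfderiv_grad g he hf hs).symm.trans
    ((congrArg (mfderiv (𝓡 n) (𝓡 n) e (γ t).proj) (hcov t ht).symm).trans
      (h1.trans (congrArg (fun v => _ + christoffelVec g _ _ _ v) hW.self_of_nhds)))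
  refine hasMFDerivAt_of_tangentCoord_comp g he hf hev ?_
  convert! hd.self_of_nhds.prodMk hd2 using 1
  exact Prod.ext rfl (sub_eq_iff_eq_add.2 h2)

theorem isMIntegralCurveOn_hamiltonField_iff (hf : ContMDiff (𝓡 n) 𝓘(ℝ, ℝ) ∞ f) {J : Set ℝ}
    (hJ : IsOpen J) (γ : ℝ → TangentBundle (𝓡 n) M) :
    IsMIntegralCurveOn γ (hamiltonField g f) J ↔
      (∀ t ∈ J, γ t = lift (fun τ => (γ τ).proj) t) ∧
        IsTrajectoryOn g f (fun τ => (γ τ).proj) J := by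
  constructor
  · intro h
    have h' := fun t ht => (h t ht).hasMFDerivAt (hJ.mem_nhds ht)
    exact ⟨fun t ht => velocity_eq_snd g hf (h' t ht), isTrajectoryOn_of_hasMFDerivAt g hf hJ h'⟩
  · rintro ⟨hl, hx⟩ t ht
    exact (hasMFDerivAt_of_isTrajectoryOn g hf hJ hl hx ht).hasMFDerivWithinAt

end Curves

end GeomDyn

end

theorem mainTheorem4 {n r s : ℕ} {M : Type*} [TopologicalSpace M]
    [ChartedSpace (EuclideanSpace ℝ (Fin n)) M] [IsManifold (𝓡 n) ∞ M]
    (g : GeomDyn.SemiRiemannianMetric n r s M)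
    (X : ∀ x : M, TangentSpace (𝓡 n) x)
    (hX : ContMDiff (𝓡 n) (𝓡 n).tangent ∞ (fun x => (⟨x, X x⟩ : TangentBundle (𝓡 n) M))) :
    -- the forms `Ω₁` and `η₁` have the stated expressions in every chart
    (∀ e ∈ IsManifold.maximalAtlas (𝓡 n) ∞ M, ∀ p : TangentBundle (𝓡 n) M, p.proj ∈ e.source →
      GeomDyn.Omega1 g p = GeomDyn.Omega1In g e p ∧ GeomDyn.eta1 g p = GeomDyn.eta1In g e p) ∧
    -- `Ω₁` is symplectic and `Ω₁ = -dη₁`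
    GeomDyn.IsSymplectic (𝓡 n).tangent (GeomDyn.Omega1 g) ∧
    GeomDyn.IsSmoothForm (𝓡 n).tangent (GeomDyn.eta1 g) ∧
    (∀ p : TangentBundle (𝓡 n) M,
      GeomDyn.Omega1 g p = -GeomDyn.extDer (𝓡 n).tangent (GeomDyn.eta1 g) p) ∧
    -- the Hamiltonian is smooth and has exactly one Hamilton gradient `Z`, which is smooth, and
    -- the solutions of the Hamilton equations are exactly the lifts of the trajectories
    ContMDiff (𝓡 n).tangent 𝓘(ℝ, ℝ) ∞ (GeomDyn.hamiltonian g (GeomDyn.energy g X)) ∧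
    ∃ Z : ∀ p : TangentBundle (𝓡 n) M, TangentSpace (𝓡 n).tangent p,
      ContMDiff (𝓡 n).tangent (𝓡 n).tangent.tangent ∞
        (fun p => (⟨p, Z p⟩ : TangentBundle (𝓡 n).tangent (TangentBundle (𝓡 n) M))) ∧
      (∀ Z' : ∀ p : TangentBundle (𝓡 n) M, TangentSpace (𝓡 n).tangent p,
        GeomDyn.IsHamiltonGradient (𝓡 n).tangent (GeomDyn.Omega1 g)
          (GeomDyn.hamiltonian g (GeomDyn.energy g X)) Z' ↔ Z' = Z) ∧
      ∀ J : Set ℝ, IsOpen J → ∀ γ : ℝ → TangentBundle (𝓡 n) M,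
        IsMIntegralCurveOn γ Z J ↔
          (∀ t ∈ J, γ t = GeomDyn.lift (fun τ => (γ τ).proj) t) ∧
            GeomDyn.IsTrajectoryOn g (GeomDyn.energy g X) (fun τ => (γ τ).proj) J := by
  have hE := GeomDyn.contMDiff_energy g hX
  refine ⟨fun e he p hp => ⟨GeomDyn.Omega1_eq_Omega1In g he hp, GeomDyn.eta1_eq_eta1In g he hp⟩,
    GeomDyn.isSymplectic_Omega1 g, GeomDyn.isSmoothForm_eta1 g, GeomDyn.Omega1_eq_neg_extDer g,
    GeomDyn.contMDiff_hamiltonian g hE, GeomDyn.hamiltonField g (GeomDyn.energy g X),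
    GeomDyn.contMDiff_hamiltonField g hE, GeomDyn.isHamiltonGradient_iff g hE, ?_⟩
  exact fun J hJ γ => GeomDyn.isMIntegralCurveOn_hamiltonField_iff g hE hJ γ
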